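/- **Theorem 3.1 (Partial entropy bound).** Let $M,N,k\ge 0$ be integers. For $1\le i<j\le M+N$ and $\theta\in\mathbb R$ let $r_{(i,j)}(\theta)$ be the rotation of $\mathbb R^{M+N}$ such that $r_{(i,j)}(\theta)^{-1}v$ has $i$-th coordinate $v_i\cos\theta-v_j\sin\theta$, $j$-th coordinate $v_i\sin\theta+v_j\cos\theta$, and all other coordinates equal to those of $v$. Given pairs $\underline\alpha=(\alpha_1,\dots,\alpha_k)$ and angles $\underline\theta=(\theta_1,\dots,\theta_k)$, let $A_k$ be the upper left $M\times M$ block of $[r_{\alpha_1}(\theta_1)\cdots r_{\alpha_k}(\theta_k)]^{-1}$, and let $A_k=U_k\Gamma_kV_k^T$ be a singular value decomposition of it, with $U_k,V_k$ orthogonal $M\times M$ matrices and $\Gamma_k=\mathrm{diag}(\gamma_1,\dots,\gamma_M)$, $\gamma_j\ge 0$ (so that in fact $\gamma_j\in[0,1]$). For a nonnegative function $h$ on $\mathbb R^m$ write $\mathcal S(h)=\int_{\mathbb R^m}h\log h\,e^{-\pi|v|^2}\,dv$ (with $0\log 0=0$). For $h$ on $\mathbb R^M$ and $\sigma\subset\{1,\dots,M\}$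 with complement $\sigma^c$, let the marginal $h^\sigma$ be the function of the variables $(v_i)_{i\in\sigma^c}$ obtained by integrating $h(v)$ over the variables $v_j$, $j\in\sigma$, against $e^{-\pi\sum_{j\in\sigma}v_j^2}\prod_{j\in\sigma}dv_j$, and let $P_{\sigma^c}:\mathbb R^M\to\mathbb R^{|\sigma^c|}$, $P_{\sigma^c}v=(v_i)_{i\in\sigma^c}$. Let $h_0\in L^1(\mathbb R^M,e^{-\pi|v|^2}dv)$ be nonnegative with $\mathcal S(h_0)<\infty$, put $h_{0,U_k}(v)=h_0(U_kv)$ and $$g_k(v)=\int_{\mathbb R^M}h_{0,U_k}\big(\Gamma_kv+(I_M-\Gamma_k^2)^{1/2}w\big)\,e^{-\pi|w|^2}\,dw .$$ Then the integrals defining $g_k$ and the marginals $h_{0,U_k}^\sigma$ converge for almost every argument, all the integrals in the following inequality converge absolutely, and $$\mathcal S(g_k)\le\sum_{\sigma\subset\{1,\dots,M\}}\ \prod_{i\in\sigma^c}\gamma_i^2\prod_{j\in\sigma}(1-\gamma_j^2)\int_{\mathbb R^M}h_0(v)\,\log h_{0,U_k}^\sigma\big(P_{\sigma^c}U_k^Tv\big)\,e^{-\pi|v|^2}\,dv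 .$$ -/

import Mathlib

open MeasureTheory
open scoped Matrix

noncomputable section

namespace KacEntropy

/-- The Gaussian measure `e^{-π |v|²} dv` on the Euclidean space `ℝ^ι`. -/
def gaussMeasure (ι : Type*) [Fintype ι] : Measure (EuclideanSpace ℝ ι) :=
  (volume : Measure (EuclideanSpace ℝ ι)).withDensity
    (fun v => ENNReal.ofReal (Real.exp (-Real.pi * ‖v‖ ^ 2)))

/-- The entropy `𝒮(h) = ∫ h log h e^{-π |v|²} dv`. -/
def entropy {ι : Type*} [Fintype ι] (h : EuclideanSpace ℝ ι → ℝ) : ℝ :=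
  ∫ v, h v * Real.log (h v) ∂(gaussMeasure ι)

/-- `𝒮(h) < ∞`. For measurable `h ≥ 0` one has `h log h ≥ -1/e` and the Gaussian measure is finite,
so `∫ h log h e^{-π |v|²} dv` always exists in `(-∞, ∞]`, and it is less than `∞` exactly when
`h log h` is integrable. -/
def HasFiniteEntropy {ι : Type*} [Fintype ι] (h : EuclideanSpace ℝ ι → ℝ) : Prop :=
  Integrable (fun v => h v * Real.log (h v)) (gaussMeasure ι)

/-- The rotation `r_{ij}(θ)` of the `(i, j)`-plane, with the orientation for which
`r_{ij}(θ)⁻¹ v` has `i`-th coordinate `v_i cos θ - v_j sin θ`, `j`-th coordinate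
`v_i sin θ + v_j cos θ`, and all other coordinates unchanged. -/
def rot {n : ℕ} (i j : Fin n) (θ : ℝ) : Matrix (Fin n) (Fin n) ℝ :=
  Matrix.of fun a b =>
    if a = i then (if b = i then Real.cos θ else if b = j then Real.sin θ else 0)
    else if a = j then (if b = i then -Real.sin θ else if b = j then Real.cos θ else 0)
    else if a = b then 1 else 0

/-- Pairs of particles `α = (i, j)`, `i < j`. -/
abbrev Pair (n : ℕ) : Type := {p : Fin n × Fin n // p.1 < p.2}

/-- The matrix `[∏_{l=1}^k r_{α_l}(θ_l)]⁻¹`; the product is in the order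
`r_{α_1}(θ_1) r_{α_2}(θ_2) ⋯ r_{α_k}(θ_k)`. -/
def collisionInv {n k : ℕ} (α : Fin k → Pair n) (θ : Fin k → ℝ) : Matrix (Fin n) (Fin n) ℝ :=
  ((List.ofFn fun l => rot (α l).1.1 (α l).1.2 (θ l)).prod)⁻¹

/-- The upper left `M × M` block `A_k(α, θ)` of `[∏_{l=1}^k r_{α_l}(θ_l)]⁻¹`; the first `M`
coordinates are those of the system, the last `N` those of the reservoir. -/
def blockA {M N k : ℕ} (α : Fin k → Pair (M + N)) (θ : Fin k → ℝ) : Matrix (Fin M) (Fin M) ℝ :=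
  (collisionInv α θ).submatrix (Fin.castAdd N) (Fin.castAdd N)

/-- `A = U Γ Vᵀ` with `U`, `V` orthogonal and `Γ = diag(γ)`, `γ ≥ 0`: an orthogonal singular value
decomposition of the square matrix `A`, with singular values `γ_j` in any order. -/
structure IsSVD {M : ℕ} (A U : Matrix (Fin M) (Fin M) ℝ) (γ : Fin M → ℝ)
    (V : Matrix (Fin M) (Fin M) ℝ) : Prop where
  left_orthogonal : U ∈ Matrix.orthogonalGroup (Fin M) ℝ
  right_orthogonal : V ∈ Matrix.orthogonalGroup (Fin M) ℝ
  nonneg : ∀ j, 0 ≤ γ j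
  eq_mul : A = U * Matrix.diagonal γ * Vᵀ

/-- The matrix `B` acting on Euclidean vectors. -/
def act {ι : Type*} [Fintype ι] (B : Matrix ι ι ℝ) (v : EuclideanSpace ℝ ι) :
    EuclideanSpace ℝ ι :=
  WithLp.toLp 2 (B *ᵥ (fun i => v i))

/-- `h_U(v) = h(U v)`. -/
def rotated {ι : Type*} [Fintype ι] (h : EuclideanSpace ℝ ι → ℝ) (U : Matrix ι ι ℝ) :
    EuclideanSpace ℝ ι → ℝ :=
  fun v => h (act U v)

/-- The vector `γ v + (I - γ²)^{1/2} w`, for the diagonal matrix `γ`. -/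
def ouPoint {ι : Type*} (γ : ι → ℝ) (v w : EuclideanSpace ℝ ι) : EuclideanSpace ℝ ι :=
  WithLp.toLp 2 (fun i => γ i * v i + Real.sqrt (1 - γ i ^ 2) * w i)

/-- `g(v) = ∫ h(γ v + (I - γ²)^{1/2} w) e^{-π |w|²} dw`. -/
def ouAverage {ι : Type*} [Fintype ι] (h : EuclideanSpace ℝ ι → ℝ) (γ : ι → ℝ) :
    EuclideanSpace ℝ ι → ℝ :=
  fun v => ∫ w, h (ouPoint γ v w) ∂(gaussMeasure ι)

/-- The orthogonal coordinate projection `P_τ : ℝ^ι → ℝ^τ`. -/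
def proj {ι : Type*} (τ : Finset ι) (v : EuclideanSpace ℝ ι) : EuclideanSpace ℝ τ :=
  WithLp.toLp 2 (fun i => v i)

/-- The vector of `ℝ^ι` whose coordinates in `σ` are given by `y` and the others by `x`. -/
def glue {ι : Type*} [Fintype ι] [DecidableEq ι] (σ : Finset ι) (y : EuclideanSpace ℝ σ)
    (x : EuclideanSpace ℝ (σᶜ : Finset ι)) : EuclideanSpace ℝ ι :=
  WithLp.toLp 2 (fun i =>
    if hi : i ∈ σ then y ⟨i, hi⟩ else x ⟨i, Finset.mem_compl.mpr hi⟩)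

/-- The marginal `h^σ`, a function of the variables outside `σ`: the variables `v_j`, `j ∈ σ`, are
integrated out against the Gaussian measure. -/
def marginal {ι : Type*} [Fintype ι] [DecidableEq ι] (h : EuclideanSpace ℝ ι → ℝ)
    (σ : Finset ι) : EuclideanSpace ℝ (σᶜ : Finset ι) → ℝ :=
  fun x => ∫ y, h (glue σ y x) ∂(gaussMeasure σ)

end KacEntropy

end

/-! The bound comes from a one-dimensional inequality used one coordinate at a time. For the
Gaussian average `P f (x) = ∫ f (r x + √(1 - r²) w)`, with `m` the mean of `f`, one has `∫ P f log P
f ≤ r² ∫ f log f + (1 - r²) m log m` (`integral_mulLog_ouMean_le`). As `Γ` is diagonal, `g` is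
obtained by independent averages of this kind in the coordinates. The inequality in coordinate `i`
bounds the entropy by the convex combination, with weights `γ i ^ 2` and `1 - γ i ^ 2`, of the
entropies where `γ i` is replaced by `1` (no averaging) or by `0` (complete averaging). Treating
every coordinate this way (`le_sum_powerset_of_coordinatewise`) leaves a sum over `σ` of the
entropies of the marginals. Finally `∫ h^σ log h^σ = ∫ h log h^σ`, since the logarithm does not
depend on the variables in `σ`. The rotation `U` preserves the Gaussian measure, and `γ j ≤ 1`
because `A` is a block of an orthogonal matrix.

The one-dimensional inequality starts on two points, where it is a termwise comparison of power
series in `t ^ 2` (`mulLog_two_point_normalized`). Sub-additivity of entropy carries it to products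
of finite chains with the same constant (`EntropyContraction.prod`), hence to sums of correlated
signs, and the central limit theorem carries it to Gaussian pairs of correlation `r`. For the limit,
the left side is linearized by the duality `t log t = sup_b (t b + t - exp b)` for `t ≥ 0`.
Approximation then removes continuity and boundedness. -/

namespace KacEntropy

/-! ### The function `t log t` and the two-point inequality -/

/-- The function `t ↦ t log t`. -/
noncomputable def mulLog (t : ℝ) : ℝ := t * Real.log t

lemma mulLog_mul {m t : ℝ} (hm : 0 < m) (ht : 0 ≤ t) :
    mulLog (m * t) = m * mulLog t + t * mulLog m := by
  rcases ht.eq_or_lt with rfl | ht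
  · simp [mulLog]
  · simp only [mulLog, Real.log_mul hm.ne' ht.ne']; ring

/-- Young's inequality for the convex function `t log t - t`, whose conjugate is `exp`. For `t > 0`
it is `1 + x ≤ exp x` at `x = b - log t`, with equality at `b = log t`. It serves both as the
tangent-line bound and as the source of every dual formulation below. -/
lemma mulLog_ge_linear {t : ℝ} (ht : 0 ≤ t) (b : ℝ) : t * b + t - Real.exp b ≤ mulLog t := by
  rcases ht.eq_or_lt with rfl | ht
  · simp [mulLog, (Real.exp_pos b).le]
  · have h := Real.add_one_le_exp (b - Real.log t)
    rw [Real.exp_sub, Real.exp_log ht, le_div_iff₀ ht] at h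
    simp only [mulLog]
    nlinarith

/-- `(1 + t) log (1 + t) + (1 - t) log (1 - t)` as a power series with nonnegative coefficients. -/
lemma hasSum_mulLog_one_add {t : ℝ} (ht : |t| < 1) :
    HasSum (fun k : ℕ => (2 / (2 * k + 1) - 1 / (k + 1) : ℝ) * (t ^ 2) ^ (k + 1))
      (mulLog (1 + t) + mulLog (1 - t)) := by
  have h1 := (Real.hasSum_log_sub_log_of_abs_lt_one ht).mul_left t
  have h2 := Real.hasSum_pow_div_log_of_abs_lt_one (x := t ^ 2)
    (by rw [abs_pow]; exact pow_lt_one₀ (abs_nonneg t) ht two_ne_zero)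
  have h3 := h1.sub h2
  obtain ⟨ha, hb⟩ := abs_lt.1 ht
  convert! h3 using 1
  · funext k
    have h4 : (2 * (k : ℝ) + 1) ≠ 0 := by positivity
    have h5 : ((k : ℝ) + 1) ≠ 0 := by positivity
    field_simp
    ring
  · rw [show 1 - t ^ 2 = (1 + t) * (1 - t) by ring,
      Real.log_mul (by linarith) (by linarith)]
    simp only [mulLog]; ring

/-- The series has nonnegative coefficients and starts with the first power of `t ^ 2`. Replacing
`t` by `r t` multiplies the term of index `k` by `(r ^ 2) ^ (k + 1) ≤ r ^ 2`. -/
lemma mulLog_two_point_normalized {t r : ℝ} (ht : |t| < 1) (hr : |r| ≤ 1) :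
    mulLog (1 + r * t) + mulLog (1 - r * t) ≤ r ^ 2 * (mulLog (1 + t) + mulLog (1 - t)) := by
  have hrt : |r * t| < 1 := by
    rw [abs_mul]; exact (mul_le_of_le_one_left (abs_nonneg t) hr).trans_lt ht
  refine hasSum_le (fun k => ?_) (hasSum_mulLog_one_add hrt)
    ((hasSum_mulLog_one_add ht).mul_left (r ^ 2))
  have hc : (0 : ℝ) ≤ 2 / (2 * k + 1) - 1 / (k + 1) := by
    rw [sub_nonneg, div_le_div_iff₀ (by positivity) (by positivity)]; linarith
  have hr2 : r ^ 2 ≤ 1 := (sq_le_one_iff_abs_le_one r).2 hr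
  rw [mul_left_comm, mul_pow r t, mul_pow]
  refine mul_le_mul_of_nonneg_left (mul_le_mul_of_nonneg_right ?_ (by positivity)) hc
  exact pow_le_of_le_one (sq_nonneg r) hr2 (Nat.succ_ne_zero k)

/-- Scaling by the mean `m` reduces to mean `1`: by `mulLog_mul` the extra terms are linear in the
arguments, so they depend only on the mean, and they account for the `mulLog m` term. -/
lemma mulLog_two_point {m d r : ℝ} (hd : |d| < m) (hr : |r| ≤ 1) :
    mulLog (m + r * d) + mulLog (m - r * d) ≤
      r ^ 2 * (mulLog (m + d) + mulLog (m - d)) + (1 - r ^ 2) * (2 * mulLog m) := by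
  have hm : 0 < m := (abs_nonneg d).trans_lt hd
  have ht : |d / m| < 1 := by rwa [abs_div, abs_of_pos hm, div_lt_one hm]
  have hrt : |r * (d / m)| < 1 := by
    rw [abs_mul]; exact (mul_le_of_le_one_left (abs_nonneg _) hr).trans_lt ht
  have h := mulLog_two_point_normalized ht hr
  obtain ⟨ha, hb⟩ := abs_lt.1 ht
  obtain ⟨hc, he⟩ := abs_lt.1 hrt
  have e1 : m + d = m * (1 + d / m) := by field_simp
  have e2 : m - d = m * (1 - d / m) := by field_simp
  have e3 : m + r * d = m * (1 + r * (d / m)) := by field_simp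
  have e4 : m - r * d = m * (1 - r * (d / m)) := by field_simp
  rw [e1, e2, e3, e4, mulLog_mul hm (by linarith), mulLog_mul hm (by linarith),
    mulLog_mul hm (by linarith), mulLog_mul hm (by linarith)]
  nlinarith [mul_le_mul_of_nonneg_left h hm.le]

/-! ### Entropy contraction for finite chains and its tensorization -/

/-- A Markov matrix `K` on a finite set, with invariant distribution `p`, contracting entropy with
constant `c`. -/
structure EntropyContraction {X : Type*} [Fintype X] (p : X → ℝ) (K : X → X → ℝ) (c : ℝ) :
    Prop where
  weight_pos : ∀ x, 0 < p x
  weight_sum : ∑ x, p x = 1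
  kernel_nonneg : ∀ x y, 0 ≤ K x y
  kernel_sum : ∀ x, ∑ y, K x y = 1
  invariant : ∀ y, ∑ x, p x * K x y = p y
  contract : ∀ F : X → ℝ, (∀ x, 0 < F x) →
    ∑ x, p x * mulLog (∑ y, K x y * F y) ≤
      c * ∑ x, p x * mulLog (F x) + (1 - c) * mulLog (∑ x, p x * F x)

lemma entropyContraction_unit (c : ℝ) :
    EntropyContraction (X := Unit) (fun _ => 1) (fun _ _ => 1) c where
  weight_pos _ := one_pos
  weight_sum := by simp
  kernel_nonneg _ _ := zero_le_one
  kernel_sum _ := by simp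
  invariant _ := by simp
  contract F _ := by simp; linarith

/-- The noise kernel on two points. -/
noncomputable def noiseKernel (r : ℝ) (x y : Bool) : ℝ := if x = y then (1 + r) / 2 else (1 - r) / 2

lemma entropyContraction_noiseKernel {r : ℝ} (hr : |r| ≤ 1) :
    EntropyContraction (fun _ => 1 / 2) (noiseKernel r) (r ^ 2) where
  weight_pos _ := by norm_num
  weight_sum := by simp
  kernel_nonneg x y := by
    obtain ⟨h1, h2⟩ := abs_le.1 hr
    unfold noiseKernel
    split_ifs <;> linarith
  kernel_sum x := by cases x <;> simp [noiseKernel] <;> ring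
  invariant x := by cases x <;> simp [noiseKernel] <;> ring
  contract F hF := by
    -- In terms of the mean `m` and half-difference `d` of `F`, the kernel sends the values `m ± d`
    -- to `m ± r d`.
    have h := mulLog_two_point (m := (F true + F false) / 2) (d := (F true - F false) / 2) (r := r)
      (by rw [abs_lt]; constructor <;> linarith [hF true, hF false]) hr
    simp only [Fintype.sum_bool, noiseKernel, if_true, reduceCtorEq, if_false]
    rw [show (1 + r) / 2 * F true + (1 - r) / 2 * F false =
        (F true + F false) / 2 + r * ((F true - F false) / 2) by ring,
      show (1 - r) / 2 * F true + (1 + r) / 2 * F false =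
        (F true + F false) / 2 - r * ((F true - F false) / 2) by ring,
      show 1 / 2 * F true + 1 / 2 * F false = (F true + F false) / 2 by ring]
    rw [show (F true + F false) / 2 + (F true - F false) / 2 = F true by ring,
      show (F true + F false) / 2 - (F true - F false) / 2 = F false by ring] at h
    linarith

/-- Sub-additivity of entropy: the entropies of the two marginals are bounded by the joint one. -/
lemma sum_mulLog_marginals_le {X Y : Type*} [Fintype X] [Fintype Y] {p : X → ℝ} {q : Y → ℝ}
    (hp : ∀ x, 0 < p x) (hps : ∑ x, p x = 1) (hq : ∀ y, 0 < q y) (hqs : ∑ y, q y = 1)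
    {F : X → Y → ℝ} (hF : ∀ x y, 0 < F x y) :
    ∑ x, p x * mulLog (∑ y, q y * F x y) + ∑ y, q y * mulLog (∑ x, p x * F x y) ≤
      ∑ x, ∑ y, p x * q y * mulLog (F x y) + mulLog (∑ x, ∑ y, p x * q y * F x y) := by
  have hX : (Finset.univ : Finset X).Nonempty := by
    by_contra h; rw [Finset.not_nonempty_iff_eq_empty] at h; simp [h] at hps
  have hY : (Finset.univ : Finset Y).Nonempty := by
    by_contra h; rw [Finset.not_nonempty_iff_eq_empty] at h; simp [h] at hqs
  set B : X → ℝ := fun x => ∑ y, q y * F x y with hB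
  set A : Y → ℝ := fun y => ∑ x, p x * F x y with hA
  set m : ℝ := ∑ x, ∑ y, p x * q y * F x y with hm
  have hBpos : ∀ x, 0 < B x := fun x => Finset.sum_pos (fun y _ => mul_pos (hq y) (hF x y)) hY
  have hApos : ∀ y, 0 < A y := fun y => Finset.sum_pos (fun x _ => mul_pos (hp x) (hF x y)) hX
  have hBm : ∑ x, p x * B x = m := by
    simp only [hB, hm, Finset.mul_sum, mul_assoc]
  have hAm : ∑ y, q y * A y = m := by
    simp only [hA, hm, Finset.mul_sum]
    rw [Finset.sum_comm]
    refine Finset.sum_congr rfl fun x _ => Finset.sum_congr rfl fun y _ => by ring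
  have hmpos : 0 < m := hBm ▸ Finset.sum_pos (fun x _ => mul_pos (hp x) (hBpos x)) hX
  have key : ∀ x y, p x * q y * (F x y - A y * B x / m) ≤
      p x * q y * mulLog (F x y) + p x * q y * F x y * Real.log m
        - p x * (q y * F x y) * Real.log (B x) - q y * (p x * F x y) * Real.log (A y) := by
    intro x y
    -- The slope is the logarithm of `A y * B x / m`, the product density with the same marginals as
    -- `F`. Summed up, this is the nonnegativity of the relative entropy of `F` with respect to that
    -- product.
    have h := mulLog_ge_linear (hF x y).le (Real.log (A y) + Real.log (B x) - Real.log m)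
    rw [Real.exp_sub, Real.exp_add, Real.exp_log (hApos y), Real.exp_log (hBpos x),
      Real.exp_log hmpos] at h
    have h2 := mul_le_mul_of_nonneg_left h (mul_pos (hp x) (hq y)).le
    nlinarith
  have hsum := Finset.sum_le_sum fun x (_ : x ∈ Finset.univ) =>
    Finset.sum_le_sum fun y (_ : y ∈ Finset.univ) => key x y
  have hleft : ∑ x, ∑ y, p x * q y * (F x y - A y * B x / m) = 0 := by
    have : ∑ x, ∑ y, p x * q y * (A y * B x / m) = m := by
      calc _ = ∑ x, ∑ y, (p x * B x) * (q y * A y) / m := by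
            refine Finset.sum_congr rfl fun x _ => Finset.sum_congr rfl fun y _ => by ring
        _ = (∑ x, p x * B x) * (∑ y, q y * A y) / m := by
            rw [Finset.sum_mul_sum, Finset.sum_div]
            simp only [Finset.sum_div]
        _ = m := by rw [hBm, hAm]; field_simp
    simp only [mul_sub, Finset.sum_sub_distrib, this]
    rw [← hm]; ring
  rw [hleft] at hsum
  simp only [Finset.sum_sub_distrib, Finset.sum_add_distrib, ← Finset.sum_mul,
    ← Finset.mul_sum] at hsum
  have e1 : ∑ x, p x * (∑ y, q y * F x y) * Real.log (B x) = ∑ x, p x * mulLog (B x) := by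
    refine Finset.sum_congr rfl fun x _ => by simp only [mulLog, hB]; ring
  have e2 : ∑ x, ∑ y, q y * (p x * F x y) * Real.log (A y) = ∑ y, q y * mulLog (A y) := by
    rw [Finset.sum_comm]
    refine Finset.sum_congr rfl fun y _ => ?_
    simp only [← Finset.sum_mul, ← Finset.mul_sum, mulLog, hA]; ring
  rw [e1, e2] at hsum
  have e3 : mulLog m = m * Real.log m := rfl
  simp only [e3] at hsum ⊢
  linarith

lemma weighted_sum_pos {Z : Type*} [Fintype Z] {a f : Z → ℝ} (ha : ∀ z, 0 ≤ a z)
    (has : ∑ z, a z = 1) (hf : ∀ z, 0 < f z) : 0 < ∑ z, a z * f z := by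
  refine Finset.sum_pos' (fun z _ => mul_nonneg (ha z) (hf z).le) ?_
  by_contra h
  push Not at h
  have : ∑ z, a z = 0 := Finset.sum_eq_zero fun z hz =>
    le_antisymm (nonpos_of_mul_nonpos_left (h z hz) (hf z)) (ha z)
  linarith

/-- Contraction in the first variable, then in the second, leaves `c ^ 2` times the joint entropy,
`c * (1 - c)` times the sum of the two marginal entropies, and `(1 - c) ^ 2` times the entropy of
the mean. Sub-additivity bounds the middle sum by the joint entropy plus that of the mean, and the
coefficients recombine to `c` and `1 - c`. -/
lemma EntropyContraction.prod {X Y : Type*} [Fintype X] [Fintype Y] {p : X → ℝ} {K : X → X → ℝ}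
    {q : Y → ℝ} {L : Y → Y → ℝ} {c : ℝ} (hc0 : 0 ≤ c) (hc1 : c ≤ 1)
    (hK : EntropyContraction p K c) (hL : EntropyContraction q L c) :
    EntropyContraction (fun z : X × Y => p z.1 * q z.2) (fun z w => K z.1 w.1 * L z.2 w.2) c where
  weight_pos z := mul_pos (hK.weight_pos _) (hL.weight_pos _)
  weight_sum := by
    rw [Fintype.sum_prod_type, ← Finset.sum_mul_sum, hK.weight_sum, hL.weight_sum, one_mul]
  kernel_nonneg _ _ := mul_nonneg (hK.kernel_nonneg _ _) (hL.kernel_nonneg _ _)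
  kernel_sum z := by
    rw [Fintype.sum_prod_type, ← Finset.sum_mul_sum, hK.kernel_sum, hL.kernel_sum, one_mul]
  invariant w := by
    rw [Fintype.sum_prod_type, ← hK.invariant, ← hL.invariant, Finset.sum_mul_sum]
    refine Finset.sum_congr rfl fun x _ => Finset.sum_congr rfl fun y _ => by ring
  contract F hF := by
    set G : Y → X → ℝ := fun y x' => ∑ y', L y y' * F (x', y') with hG
    set A : Y → ℝ := fun y' => ∑ x', p x' * F (x', y') with hA
    have hGpos : ∀ y x', 0 < G y x' := fun y x' =>
      weighted_sum_pos (hL.kernel_nonneg y) (hL.kernel_sum y) fun _ => hF _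
    have hApos : ∀ y', 0 < A y' := fun y' =>
      weighted_sum_pos (fun x => (hK.weight_pos x).le) hK.weight_sum fun _ => hF _
    have h1 := fun y => mul_le_mul_of_nonneg_left (hK.contract (G y) (hGpos y)) (hL.weight_pos y).le
    have h2 := fun x' => mul_le_mul_of_nonneg_left
      (hL.contract (fun y' => F (x', y')) fun _ => hF _) (hK.weight_pos x').le
    have h3 := hL.contract A hApos
    have h4 := sum_mulLog_marginals_le hK.weight_pos hK.weight_sum hL.weight_pos hL.weight_sum
      (F := fun x y => F (x, y)) fun _ _ => hF _
    have s1 := Finset.sum_le_sum fun y (_ : y ∈ Finset.univ) => h1 y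
    have s2 := Finset.sum_le_sum fun x (_ : x ∈ Finset.univ) => h2 x
    have e1 : ∑ z : X × Y, p z.1 * q z.2 * mulLog (∑ w : X × Y, K z.1 w.1 * L z.2 w.2 * F w) =
        ∑ y, q y * ∑ x, p x * mulLog (∑ x', K x x' * G y x') := by
      rw [Fintype.sum_prod_type_right]
      refine Finset.sum_congr rfl fun y _ => ?_
      rw [Finset.mul_sum]
      refine Finset.sum_congr rfl fun x _ => ?_
      simp only [hG, Fintype.sum_prod_type, Finset.mul_sum, mul_assoc]
      ring
    have e2 : ∑ y, q y * ∑ x, p x * mulLog (G y x) = ∑ x, p x * ∑ y, q y * mulLog (G y x) := by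
      simp only [Finset.mul_sum]
      rw [Finset.sum_comm]
      exact Finset.sum_congr rfl fun x _ => Finset.sum_congr rfl fun y _ => by ring
    have e3 : ∀ y, ∑ x, p x * G y x = ∑ y', L y y' * A y' := by
      intro y
      simp only [hG, hA, Finset.mul_sum]
      rw [Finset.sum_comm]
      exact Finset.sum_congr rfl fun x _ => Finset.sum_congr rfl fun y _ => by ring
    have e4 : ∑ y, q y * A y = ∑ x, ∑ y, p x * q y * F (x, y) := by
      simp only [hA, Finset.mul_sum]
      rw [Finset.sum_comm]
      exact Finset.sum_congr rfl fun x _ => Finset.sum_congr rfl fun y _ => by ring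
    have e5 : ∑ x, p x * ∑ y, q y * mulLog (F (x, y)) =
        ∑ x, ∑ y, p x * q y * mulLog (F (x, y)) := by
      simp only [Finset.mul_sum, mul_assoc]
    simp only [mul_add, Finset.sum_add_distrib, mul_left_comm _ c, mul_left_comm _ (1 - c),
      ← Finset.mul_sum, e2, e3] at s1
    simp only [mul_add, Finset.sum_add_distrib, mul_left_comm _ c, mul_left_comm _ (1 - c),
      ← Finset.mul_sum, e5] at s2
    rw [e4] at h3
    rw [e1, Fintype.sum_prod_type, Fintype.sum_prod_type]
    have hc2 : 0 ≤ c * (1 - c) := mul_nonneg hc0 (by linarith)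
    have t2 := mul_le_mul_of_nonneg_left s2 hc0
    have t3 := mul_le_mul_of_nonneg_left h3 (sub_nonneg.2 hc1)
    have t4 := mul_le_mul_of_nonneg_left h4 hc2
    dsimp only at *
    linarith

/-! ### Dual form and sums of correlated signs -/

open Filter Topology ProbabilityTheory
open scoped NNReal ENNReal BoundedContinuousFunction

/-- The nonlinear term `mulLog (∑ y, K x y * f y)` is replaced by its lower bounds from
`mulLog_ge_linear`. Both sides then involve only expectations under the joint law of a step, a form
that survives weak convergence. -/
lemma EntropyContraction.dual {X : Type*} [Fintype X] {p : X → ℝ} {K : X → X → ℝ} {c : ℝ}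
    (h : EntropyContraction p K c) {f φ : X → ℝ} (hf : ∀ x, 0 < f x) :
    ∑ x, ∑ y, p x * K x y * (f y * φ x + f y - Real.exp (φ x) - c * mulLog (f y)) ≤
      (1 - c) * mulLog (∑ x, ∑ y, p x * K x y * f y) := by
  have hmarg : ∀ g : X → ℝ, ∑ x, ∑ y, p x * K x y * g y = ∑ y, p y * g y := by
    intro g
    rw [Finset.sum_comm]
    simp only [← Finset.sum_mul, h.invariant]
  have h1 := h.contract f hf
  have h2 : ∑ x, p x * ((∑ y, K x y * f y) * φ x + ∑ y, K x y * f y - Real.exp (φ x)) ≤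
      ∑ x, p x * mulLog (∑ y, K x y * f y) :=
    Finset.sum_le_sum fun x _ => mul_le_mul_of_nonneg_left (mulLog_ge_linear
      (weighted_sum_pos (h.kernel_nonneg x) (h.kernel_sum x) hf).le _) (h.weight_pos x).le
  have h3 : ∑ x, ∑ y, p x * K x y * (f y * φ x + f y - Real.exp (φ x) - c * mulLog (f y)) =
      ∑ x, p x * ((∑ y, K x y * f y) * φ x + ∑ y, K x y * f y - Real.exp (φ x)) -
        c * ∑ y, p y * mulLog (f y) := by
    rw [← hmarg fun y => mulLog (f y), Finset.mul_sum, ← Finset.sum_sub_distrib]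
    refine Finset.sum_congr rfl fun x _ => ?_
    have : Real.exp (φ x) = ∑ y, K x y * Real.exp (φ x) := by
      rw [← Finset.sum_mul, h.kernel_sum, one_mul]
    conv_rhs => rw [this]
    rw [Finset.sum_mul, ← Finset.sum_add_distrib, ← Finset.sum_sub_distrib, Finset.mul_sum,
      Finset.mul_sum, ← Finset.sum_sub_distrib]
    exact Finset.sum_congr rfl fun y _ => by ring
  rw [h3, hmarg]
  linarith

/-- The joint law of `(s x, s y)` for a stationary step `x → y` of the chain `(p, K)`. -/
noncomputable def stepLaw {X : Type*} [Fintype X] (p : X → ℝ) (K : X → X → ℝ) (s : X → ℝ) :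
    Measure (WithLp 2 (ℝ × ℝ)) :=
  ∑ x, ∑ y, ENNReal.ofReal (p x * K x y) • Measure.dirac (WithLp.toLp 2 (s x, s y))

lemma integral_stepLaw {X : Type*} [Fintype X] {p : X → ℝ} {K : X → X → ℝ} {c : ℝ}
    (h : EntropyContraction p K c) (s : X → ℝ) {E : Type*} [NormedAddCommGroup E] [NormedSpace ℝ E]
    [CompleteSpace E] (F : WithLp 2 (ℝ × ℝ) → E) :
    ∫ z, F z ∂(stepLaw p K s) = ∑ x, ∑ y, (p x * K x y) • F (WithLp.toLp 2 (s x, s y)) := by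
  have hi : ∀ x y, Integrable F
      (ENNReal.ofReal (p x * K x y) • Measure.dirac (WithLp.toLp 2 (s x, s y))) := fun x y =>
    (integrable_dirac (by simp)).smul_measure ENNReal.ofReal_ne_top
  unfold stepLaw
  rw [integral_finsetSum_measure fun x _ => integrable_finsetSum_measure.2 fun y _ => hi x y]
  refine Finset.sum_congr rfl fun x _ => ?_
  rw [integral_finsetSum_measure fun y _ => hi x y]
  refine Finset.sum_congr rfl fun y _ => ?_
  rw [integral_smul_measure, integral_dirac,
    ENNReal.toReal_ofReal (mul_nonneg (h.weight_pos x).le (h.kernel_nonneg x y))]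

lemma isProbabilityMeasure_stepLaw {X : Type*} [Fintype X] {p : X → ℝ} {K : X → X → ℝ} {c : ℝ}
    (h : EntropyContraction p K c) (s : X → ℝ) : IsProbabilityMeasure (stepLaw p K s) := by
  constructor
  have hpos : ∀ x y, 0 ≤ p x * K x y := fun x y =>
    mul_nonneg (h.weight_pos x).le (h.kernel_nonneg x y)
  simp only [stepLaw, Measure.coe_finsetSum, Finset.sum_apply, Measure.smul_apply,
    measure_univ, smul_eq_mul, mul_one]
  rw [Finset.sum_congr rfl fun x _ => (ENNReal.ofReal_sum_of_nonneg fun y _ => hpos x y).symm,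
    ← ENNReal.ofReal_sum_of_nonneg fun x _ => Finset.sum_nonneg fun y _ => hpos x y]
  simp [← Finset.mul_sum, h.kernel_sum, h.weight_sum]

/-- The characteristic function of a pair of signs with correlation `r`. -/
noncomputable def signChar (r a b : ℝ) : ℝ :=
  (1 + r) / 2 * Real.cos (a + b) + (1 - r) / 2 * Real.cos (a - b)

/-- Sums of independent pairs of correlated signs. -/
lemma exists_entropyContraction_signSum {r : ℝ} (hr : |r| ≤ 1) (n : ℕ) :
    ∃ (X : Type) (_ : Fintype X) (p : X → ℝ) (K : X → X → ℝ) (s : X → ℝ),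
      EntropyContraction p K (r ^ 2) ∧ ∀ a b : ℝ,
        ∑ x, ∑ y, ((p x * K x y : ℝ) : ℂ) * Complex.exp ((s x * a + s y * b : ℝ) * Complex.I) =
          (signChar r a b : ℂ) ^ n := by
  induction n with
  | zero => exact ⟨Unit, inferInstance, _, _, fun _ => 0, entropyContraction_unit _, by simp⟩
  | succ n ih =>
    obtain ⟨X, _, p, K, s, h, hs⟩ := ih
    let sgn : Bool → ℝ := fun x => if x then 1 else -1
    -- One more independent pair of signs is added to the sum, so the joint characteristic function
    -- gains a factor `signChar r a b`.
    refine ⟨Bool × X, inferInstance, _, _, fun z => sgn z.1 + s z.2,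
      (entropyContraction_noiseKernel hr).prod (sq_nonneg r)
        ((sq_le_one_iff_abs_le_one r).2 hr) h, fun a b => ?_⟩
    have hbase : ∑ x, ∑ y, ((1 / 2 * noiseKernel r x y : ℝ) : ℂ) *
        Complex.exp ((sgn x * a + sgn y * b : ℝ) * Complex.I) = (signChar r a b : ℂ) := by
      have hcos : ∀ t : ℝ, Complex.exp (t * Complex.I) + Complex.exp ((-t : ℝ) * Complex.I) =
          2 * Real.cos t := by
        intro t
        rw [Complex.ofReal_cos, Complex.two_cos]
        push_cast; rfl
      simp only [Fintype.sum_bool, noiseKernel, sgn, if_true, reduceCtorEq, if_false,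
        Bool.false_eq_true]
      have h1 := hcos (a + b)
      have h2 := hcos (a - b)
      rw [show 1 * a + 1 * b = a + b by ring, show 1 * a + -1 * b = a - b by ring,
        show -1 * a + 1 * b = -(a - b) by ring, show -1 * a + -1 * b = -(a + b) by ring]
      simp only [signChar, Complex.ofReal_mul, Complex.ofReal_add] at h1 h2 ⊢
      push_cast at h1 h2 ⊢
      linear_combination ((1 + r) / 4 : ℂ) * h1 + ((1 - r) / 4 : ℂ) * h2
    rw [pow_succ', ← hs, ← hbase]
    simp only [Fintype.sum_prod_type]
    rw [Finset.sum_mul_sum]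
    refine Finset.sum_congr rfl fun x _ => Finset.sum_congr rfl fun x' _ => ?_
    rw [Finset.sum_mul_sum]
    refine Finset.sum_congr rfl fun y _ => Finset.sum_congr rfl fun y' _ => ?_
    have : Complex.exp (((sgn x + s x') * a + (sgn y + s y') * b : ℝ) * Complex.I) =
        Complex.exp ((sgn x * a + sgn y * b : ℝ) * Complex.I) *
          Complex.exp ((s x' * a + s y' * b : ℝ) * Complex.I) := by
      rw [← Complex.exp_add]; congr 1; push_cast; ring
    rw [this]
    push_cast
    ring

/-! ### The central limit theorem and Gaussian pairs -/

lemma tendsto_mul_cos_sub_one (t : ℝ) :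
    Tendsto (fun n : ℕ => n * (Real.cos (t / √n) - 1)) atTop (𝓝 (-t ^ 2 / 2)) := by
  rw [tendsto_iff_norm_sub_tendsto_zero]
  have hlim : Tendsto (fun n : ℕ => t ^ 4 * (5 / 96) * (1 / (n : ℝ))) atTop (𝓝 0) := by
    have h := (tendsto_one_div_atTop_nhds_zero_nat (𝕜 := ℝ)).const_mul (t ^ 4 * (5 / 96))
    rwa [mul_zero] at h
  refine squeeze_zero' (Eventually.of_forall fun _ => norm_nonneg _) ?_ hlim
  -- This puts `t / √n` in the range `|x| ≤ 1` of `Real.cos_bound`, whose fourth-order error,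
  -- multiplied by `n`, is of order `1 / n`.
  have hev : ∀ᶠ n : ℕ in atTop, t ^ 2 < n :=
    (tendsto_natCast_atTop_atTop (R := ℝ)).eventually_gt_atTop _
  filter_upwards [hev, eventually_gt_atTop 0] with n hn hn0
  have hn0' : (0 : ℝ) < n := by exact_mod_cast hn0
  have hsq : √(n : ℝ) ^ 2 = n := Real.sq_sqrt hn0'.le
  have habs : |t / √n| ≤ 1 := by
    rw [← sq_le_one_iff_abs_le_one, div_pow, hsq, div_le_one hn0']
    exact hn.le
  have hb := Real.cos_bound habs
  have e1 : (n : ℝ) * (Real.cos (t / √n) - 1) - -t ^ 2 / 2 =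
      n * (Real.cos (t / √n) - (1 - (t / √n) ^ 2 / 2)) := by
    rw [div_pow, hsq]; field_simp; ring
  have e2 : |t / √n| ^ 4 = t ^ 4 / n ^ 2 := by
    rw [show |t / √n| ^ 4 = (|t / √n| ^ 2) ^ 2 by ring, sq_abs, div_pow, hsq]; ring
  rw [e2] at hb
  rw [e1, norm_mul, Real.norm_of_nonneg hn0'.le, Real.norm_eq_abs]
  calc _ ≤ (n : ℝ) * (t ^ 4 / n ^ 2 * (5 / 96)) := mul_le_mul_of_nonneg_left hb hn0'.le
    _ = _ := by field_simp

lemma tendsto_signChar_pow (r a b : ℝ) :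
    Tendsto (fun n : ℕ => signChar r (a / √n) (b / √n) ^ n) atTop
      (𝓝 (Real.exp (-(a ^ 2 + 2 * r * a * b + b ^ 2) / 2))) := by
  have h : Tendsto (fun n : ℕ => n * (signChar r (a / √n) (b / √n) - 1)) atTop
      (𝓝 (-(a ^ 2 + 2 * r * a * b + b ^ 2) / 2)) := by
    have := ((tendsto_mul_cos_sub_one (a + b)).const_mul ((1 + r) / 2)).add
      ((tendsto_mul_cos_sub_one (a - b)).const_mul ((1 - r) / 2))
    convert! this using 2
    · simp only [signChar, add_div, sub_div]; ring
    · ring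
  simpa using Real.tendsto_one_add_pow_exp_of_tendsto h

/-- The joint law of `(x, r x + √(1 - r²) w)` for independent centered Gaussian `x`, `w`. -/
noncomputable def gaussPair (v : ℝ≥0) (r : ℝ) : Measure (WithLp 2 (ℝ × ℝ)) :=
  ((gaussianReal 0 v).prod (gaussianReal 0 v)).map
    fun z => WithLp.toLp 2 (z.1, r * z.1 + √(1 - r ^ 2) * z.2)

/-- The pair is a linear image of two independent Gaussians, so its characteristic function is that
of the product law at the transposed argument. -/
lemma charFun_gaussPair (v : ℝ≥0) {r : ℝ} (hr : |r| ≤ 1) (t : WithLp 2 (ℝ × ℝ)) :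
    charFun (gaussPair v r) t =
      Real.exp (-(v * (t.ofLp.1 ^ 2 + 2 * r * t.ofLp.1 * t.ofLp.2 + t.ofLp.2 ^ 2)) / 2) := by
  have hr2 : r ^ 2 ≤ 1 := (sq_le_one_iff_abs_le_one r).2 hr
  have hs : √(1 - r ^ 2) ^ 2 = 1 - r ^ 2 := Real.sq_sqrt (by linarith)
  have h1 := charFun_prod (μ := gaussianReal 0 v) (ν := gaussianReal 0 v)
    (WithLp.toLp 2 (t.ofLp.1 + r * t.ofLp.2, √(1 - r ^ 2) * t.ofLp.2))
  rw [charFun_apply, integral_map (by fun_prop) (by fun_prop)] at h1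
  rw [charFun_apply, gaussPair, integral_map (by fun_prop) (by fun_prop)]
  convert! h1 using 1
  · congr 1
    funext z
    simp only [WithLp.prod_inner_apply, RCLike.inner_apply, conj_trivial]
    congr 3
    ring
  · simp only [charFun_gaussianReal, Complex.ofReal_zero, mul_zero, zero_mul, zero_sub]
    rw [← Complex.exp_add, Complex.ofReal_exp]
    congr 1
    rw [Complex.ofReal_mul, mul_pow, ← Complex.ofReal_pow (√(1 - r ^ 2)), hs]
    push_cast
    ring

instance (v : ℝ≥0) (r : ℝ) : IsProbabilityMeasure (gaussPair v r) :=
  Measure.isProbabilityMeasure_map (by fun_prop)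

/-- Normalized sums of correlated signs converge in law to a correlated Gaussian pair. -/
lemma exists_stepLaw_tendsto_gaussPair (v : ℝ≥0) {r : ℝ} (hr : |r| ≤ 1) :
    ∃ (X : ℕ → Type) (_ : ∀ n, Fintype (X n)) (p : ∀ n, X n → ℝ) (K : ∀ n, X n → X n → ℝ)
      (s : ∀ n, X n → ℝ), (∀ n, EntropyContraction (p n) (K n) (r ^ 2)) ∧
      ∀ F : WithLp 2 (ℝ × ℝ) →ᵇ ℝ, Tendsto (fun n => ∫ z, F z ∂(stepLaw (p n) (K n) (s n))) atTop
        (𝓝 (∫ z, F z ∂(gaussPair v r))) := by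
  choose X hX p K s h hs using exists_entropyContraction_signSum hr
  have hprob : ∀ n, IsProbabilityMeasure
      (stepLaw (p n) (K n) fun x => √(v : ℝ) / √(n : ℝ) * s n x) :=
    fun n => isProbabilityMeasure_stepLaw (h n) _
  -- The scale makes each sum have variance `v`. At `n = 0` it is `0` by the convention for
  -- division, which does not affect the limit.
  refine ⟨X, hX, p, K, fun n x => √(v : ℝ) / √(n : ℝ) * s n x, h, ?_⟩
  let μ : ℕ → ProbabilityMeasure (WithLp 2 (ℝ × ℝ)) := fun n => ⟨_, hprob n⟩
  let μ₀ : ProbabilityMeasure (WithLp 2 (ℝ × ℝ)) := ⟨gaussPair v r, inferInstance⟩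
  refine ProbabilityMeasure.tendsto_iff_forall_integral_tendsto.1
    (ProbabilityMeasure.tendsto_of_tendsto_charFun (μ := μ) (μ₀ := μ₀) fun t => ?_)
  change Tendsto (fun n => charFun (stepLaw (p n) (K n) fun x => √(v : ℝ) / √(n : ℝ) * s n x) t)
    atTop (𝓝 (charFun (gaussPair v r) t))
  have hchar : ∀ n, charFun (stepLaw (p n) (K n) fun x => √(v : ℝ) / √(n : ℝ) * s n x) t =
      ((signChar r (√v * t.ofLp.1 / √n) (√v * t.ofLp.2 / √n) ^ n : ℝ) : ℂ) := by
    intro n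
    rw [Complex.ofReal_pow, ← hs, charFun_apply, integral_stepLaw (h n)]
    refine Finset.sum_congr rfl fun x _ => Finset.sum_congr rfl fun y _ => ?_
    rw [Complex.real_smul]
    congr 4
    simp only [WithLp.prod_inner_apply, RCLike.inner_apply, conj_trivial]
    ring
  simp only [hchar, charFun_gaussPair v hr t]
  refine (Complex.continuous_ofReal.tendsto _).comp ?_
  have hv : √(v : ℝ) ^ 2 = v := Real.sq_sqrt v.2
  convert! tendsto_signChar_pow r (√v * t.ofLp.1) (√v * t.ofLp.2) using 4
  rw [mul_pow, mul_pow, hv]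
  linear_combination (2 * r * t.ofLp.1 * t.ofLp.2) * hv

lemma continuous_mulLog : Continuous mulLog := Real.continuous_mul_log

/-- The dual form of the entropy contraction for correlated Gaussian pairs. -/
lemma gaussPair_dual (v : ℝ≥0) {r : ℝ} (hr : |r| ≤ 1) (f φ : ℝ →ᵇ ℝ) (hf : ∀ x, 0 < f x) :
    ∫ z, (f z.ofLp.2 * φ z.ofLp.1 + f z.ofLp.2 - Real.exp (φ z.ofLp.1)
        - r ^ 2 * mulLog (f z.ofLp.2)) ∂(gaussPair v r) ≤
      (1 - r ^ 2) * mulLog (∫ z, f z.ofLp.2 ∂(gaussPair v r)) := by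
  obtain ⟨X, _, p, K, s, h, hlim⟩ := exists_stepLaw_tendsto_gaussPair v hr
  obtain ⟨B, hB⟩ := (isCompact_closedBall (0 : ℝ) ‖f‖).exists_bound_of_continuousOn
    continuous_mulLog.continuousOn
  have hfB : ∀ y, |f y| ≤ ‖f‖ := f.norm_coe_le_norm
  have hφB : ∀ y, |φ y| ≤ ‖φ‖ := φ.norm_coe_le_norm
  have hmB : ∀ y, |mulLog (f y)| ≤ B := fun y => hB _ (by simpa using hfB y)
  let F₁ : WithLp 2 (ℝ × ℝ) →ᵇ ℝ := BoundedContinuousFunction.ofNormedAddCommGroup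
    (fun z => f z.ofLp.2 * φ z.ofLp.1 + f z.ofLp.2 - Real.exp (φ z.ofLp.1)
        - r ^ 2 * mulLog (f z.ofLp.2)) (by have := continuous_mulLog; fun_prop)
    (‖f‖ * ‖φ‖ + ‖f‖ + Real.exp ‖φ‖ + r ^ 2 * B) (fun z => by
      rw [Real.norm_eq_abs]
      refine (abs_sub _ _).trans (add_le_add ((abs_sub _ _).trans (add_le_add
        ((abs_add_le _ _).trans (add_le_add ?_ (hfB _))) ?_)) ?_)
      · rw [abs_mul]; exact mul_le_mul (hfB _) (hφB _) (abs_nonneg _) (norm_nonneg _)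
      · rw [Real.abs_exp]; exact Real.exp_le_exp.2 ((le_abs_self _).trans (hφB _))
      · rw [abs_mul, abs_of_nonneg (sq_nonneg r)]
        exact mul_le_mul_of_nonneg_left (hmB _) (sq_nonneg r))
  let F₂ : WithLp 2 (ℝ × ℝ) →ᵇ ℝ := BoundedContinuousFunction.ofNormedAddCommGroup
    (fun z => f z.ofLp.2) (by fun_prop) ‖f‖ (fun z => hfB _)
  -- Each side is a continuous function of the expectation of a bounded continuous function of the
  -- pair, so the inequality for finite chains passes to the limit.
  refine le_of_tendsto_of_tendsto' (hlim F₁)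
    (((continuous_mulLog.tendsto _).comp (hlim F₂)).const_mul (1 - r ^ 2)) fun n => ?_
  simp only [Function.comp, integral_stepLaw (h n), smul_eq_mul]
  exact (h n).dual (f := fun x => f (s n x)) (φ := fun x => φ (s n x)) fun x => hf _

/-! ### The one-dimensional Gaussian contraction -/

lemma neg_one_le_mulLog {t : ℝ} (ht : 0 ≤ t) : -1 ≤ mulLog t := by
  have := mulLog_ge_linear ht 0
  rw [Real.exp_zero] at this
  linarith

/-- Below, `t log t ≥ -1` and the measure is finite; above, Jensen's inequality bounds the integrand
by the fibre integral of `mulLog ∘ F`. -/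
lemma integrable_mulLog_integral {α β : Type*} [MeasurableSpace α] [MeasurableSpace β]
    {μ : Measure α} {ν : Measure β} [IsProbabilityMeasure μ] [IsProbabilityMeasure ν]
    {F : α × β → ℝ} (hF : Measurable F) (h0 : ∀ z, 0 ≤ F z) (hi : Integrable F (μ.prod ν))
    (hl : Integrable (fun z => mulLog (F z)) (μ.prod ν)) :
    Integrable (fun x => mulLog (∫ y, F (x, y) ∂ν)) μ := by
  have hm : StronglyMeasurable fun x => ∫ y, F (x, y) ∂ν :=
    hF.stronglyMeasurable.integral_prod_right'
  refine (hl.integral_prod_left.norm.add (integrable_const (1 : ℝ))).mono'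
    (continuous_mulLog.comp_stronglyMeasurable hm).aestronglyMeasurable ?_
  filter_upwards [hi.prod_right_ae, hl.prod_right_ae] with x hx hx'
  have hJ := ConvexOn.map_integral_le (μ := ν) (f := fun y => F (x, y)) Real.convexOn_mul_log
    Real.continuous_mul_log.continuousOn isClosed_Ici (Eventually.of_forall fun y => h0 _) hx hx'
  have h1 := neg_one_le_mulLog (integral_nonneg (μ := ν) fun y => h0 (x, y))
  simp only [Pi.add_apply, Real.norm_eq_abs]
  refine abs_le.2 ⟨?_, ?_⟩
  · linarith [abs_nonneg (∫ y, mulLog (F (x, y)) ∂ν)]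
  · have h2 := le_abs_self (∫ y, mulLog (F (x, y)) ∂ν)
    change mulLog (∫ y, F (x, y) ∂ν) ≤ ∫ y, mulLog (F (x, y)) ∂ν at hJ
    linarith

lemma abs_mulLog_sub_le {a b s t : ℝ} (ha : 0 < a) (hs : s ∈ Set.Icc a b) (ht : t ∈ Set.Icc a b) :
    |mulLog s - mulLog t| ≤ (1 + |Real.log a| + |Real.log b|) * |s - t| := by
  have key : ∀ s ∈ Set.Icc a b, ∀ t ∈ Set.Icc a b,
      mulLog s - mulLog t ≤ (1 + |Real.log a| + |Real.log b|) * |s - t| := by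
    intro s hs t ht
    have hs0 : 0 < s := ha.trans_le hs.1
    have h := mulLog_ge_linear (ha.le.trans ht.1) (Real.log s)
    rw [Real.exp_log hs0] at h
    have hlog : |Real.log s| ≤ |Real.log a| + |Real.log b| := by
      have h1 := Real.log_le_log ha hs.1
      have h2 := Real.log_le_log hs0 hs.2
      rw [abs_le]
      constructor <;> linarith [neg_abs_le (Real.log a), le_abs_self (Real.log b),
        abs_nonneg (Real.log a), abs_nonneg (Real.log b)]
    have h1 : mulLog s - mulLog t ≤ (1 + Real.log s) * (s - t) := by
      simp only [mulLog] at h ⊢; nlinarith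
    refine h1.trans ((le_abs_self _).trans ?_)
    rw [abs_mul]
    refine mul_le_mul_of_nonneg_right ?_ (abs_nonneg _)
    refine (abs_add_le _ _).trans ?_
    rw [abs_one]; linarith
  refine abs_le.2 ⟨?_, key s hs t ht⟩
  have := key t ht s hs
  rw [abs_sub_comm] at this
  linarith

lemma integral_comp_measurePreserving {α β : Type*} [MeasurableSpace α] [MeasurableSpace β]
    {μ : Measure α} {ν : Measure β} {g : α → β} (hg : MeasurePreserving g μ ν) {f : β → ℝ}
    (hf : AEStronglyMeasurable f ν) : ∫ x, f (g x) ∂μ = ∫ y, f y ∂ν := by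
  rw [← hg.map_eq, integral_map hg.measurable.aemeasurable (by rwa [hg.map_eq])]

/-- The point `r x + √(1 - r²) w`. -/
noncomputable def ouStep (r x w : ℝ) : ℝ := r * x + √(1 - r ^ 2) * w

lemma continuous_ouStep (r : ℝ) : Continuous fun z : ℝ × ℝ => ouStep r z.1 z.2 := by
  unfold ouStep; fun_prop

/-- The law of the step is the second marginal of `gaussPair`, so its characteristic function is
that of the pair at `(0, t)`. -/
lemma measurePreserving_ouStep (v : ℝ≥0) {r : ℝ} (hr : |r| ≤ 1) :
    MeasurePreserving (fun z : ℝ × ℝ => ouStep r z.1 z.2)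
      ((gaussianReal 0 v).prod (gaussianReal 0 v)) (gaussianReal 0 v) := by
  refine ⟨(continuous_ouStep r).measurable, ?_⟩
  have hprob : IsProbabilityMeasure (((gaussianReal 0 v).prod (gaussianReal 0 v)).map
      fun z : ℝ × ℝ => ouStep r z.1 z.2) :=
    Measure.isProbabilityMeasure_map (continuous_ouStep r).aemeasurable
  refine Measure.ext_of_charFun (funext fun t => ?_)
  have h := charFun_gaussPair v hr (WithLp.toLp 2 (0, t))
  rw [charFun_apply, gaussPair, integral_map (by fun_prop) (by fun_prop)] at h
  rw [charFun_apply, integral_map (continuous_ouStep r).aemeasurable (by fun_prop),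
    charFun_gaussianReal]
  convert! h using 1
  · congr 1
    funext z
    simp [WithLp.prod_inner_apply, ouStep]
  · push_cast
    congr 1
    ring

/-- The average of `f` over the Gaussian step from `x`. -/
noncomputable def ouMean (v : ℝ≥0) (r : ℝ) (f : ℝ → ℝ) (x : ℝ) : ℝ :=
  ∫ w, f (ouStep r x w) ∂(gaussianReal 0 v)

lemma integral_mulLog_ouMean_le_of_continuous (v : ℝ≥0) {r : ℝ} (hr : |r| ≤ 1) {f : ℝ → ℝ}
    (hf : Continuous f) {a b : ℝ} (ha : 0 < a) (hab : ∀ x, f x ∈ Set.Icc a b) :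
    ∫ x, mulLog (ouMean v r f x) ∂(gaussianReal 0 v) ≤
      r ^ 2 * ∫ x, mulLog (f x) ∂(gaussianReal 0 v) +
        (1 - r ^ 2) * mulLog (∫ x, f x ∂(gaussianReal 0 v)) := by
  set G := gaussianReal 0 v
  have hfi : ∀ x, Integrable (fun w => f (ouStep r x w)) G := fun x =>
    Integrable.of_bound (hf.comp ((continuous_ouStep r).comp (by fun_prop :
      Continuous fun w => (x, w)))).aestronglyMeasurable b (Eventually.of_forall fun w => by
      rw [Real.norm_of_nonneg (ha.le.trans (hab _).1)]; exact (hab _).2)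
  have hP : ∀ x, ouMean v r f x ∈ Set.Icc a b := fun x => by
    constructor
    · calc a = ∫ _, a ∂G := by simp
        _ ≤ _ := integral_mono (integrable_const _) (hfi x) fun w => (hab _).1
    · calc _ ≤ ∫ _, b ∂G := integral_mono (hfi x) (integrable_const _) fun w => (hab _).2
        _ = b := by simp
  have hPpos : ∀ x, 0 < ouMean v r f x := fun x => ha.trans_le (hP x).1
  have hPc : Continuous (ouMean v r f) := by
    refine continuous_of_dominated (bound := fun _ => b) (fun x => (hfi x).aestronglyMeasurable)
      (fun x => Eventually.of_forall fun w => ?_) (integrable_const _)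
      (Eventually.of_forall fun w => ?_)
    · rw [Real.norm_of_nonneg (ha.le.trans (hab _).1)]; exact (hab _).2
    · exact hf.comp ((continuous_ouStep r).comp (by fun_prop : Continuous fun x => (x, w)))
  have hlogb : ∀ x ∈ Set.Icc a b, |Real.log x| ≤ |Real.log a| + |Real.log b| := by
    intro x hx
    have h1 := Real.log_le_log ha hx.1
    have h2 := Real.log_le_log (ha.trans_le hx.1) hx.2
    rw [abs_le]
    constructor <;> linarith [neg_abs_le (Real.log a), le_abs_self (Real.log b),
        abs_nonneg (Real.log a), abs_nonneg (Real.log b)]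
  let fb : ℝ →ᵇ ℝ := BoundedContinuousFunction.ofNormedAddCommGroup f hf b fun x => by
    rw [Real.norm_of_nonneg (ha.le.trans (hab _).1)]; exact (hab _).2
  -- The optimal test function is the logarithm of the averaged function. It is bounded because
  -- averages stay in `[a, b]` with `a > 0`.
  let φ : ℝ →ᵇ ℝ := BoundedContinuousFunction.ofNormedAddCommGroup
    (fun x => Real.log (ouMean v r f x)) (hPc.log fun x => (hPpos x).ne')
    (|Real.log a| + |Real.log b|) fun x => hlogb _ (hP x)
  have h := gaussPair_dual v hr fb φ fun x => ha.trans_le (hab x).1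
  have hmp := measurePreserving_ouStep v hr
  have hmlc : Continuous fun x => mulLog (f x) := continuous_mulLog.comp hf
  have hmli : Integrable (fun x => mulLog (f x)) G := by
    refine Integrable.of_bound hmlc.aestronglyMeasurable (b * (|Real.log a| + |Real.log b|))
      (Eventually.of_forall fun x => ?_)
    rw [mulLog, norm_mul, Real.norm_of_nonneg (ha.le.trans (hab _).1)]
    exact mul_le_mul (hab _).2 (hlogb _ (hab _)) (abs_nonneg _)
      (ha.le.trans ((hab x).1.trans (hab x).2))
  have hmeas : Measurable fun z : ℝ × ℝ => WithLp.toLp 2 (z.1, r * z.1 + √(1 - r ^ 2) * z.2) := by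
    fun_prop
  have hφc := φ.continuous
  have hfc := fb.continuous
  have e1 : ∫ z, fb z.ofLp.2 ∂(gaussPair v r) = ∫ x, f x ∂G := by
    rw [gaussPair, integral_map hmeas.aemeasurable (by fun_prop)]
    exact integral_comp_measurePreserving hmp hf.aestronglyMeasurable
  rw [e1, gaussPair, integral_map hmeas.aemeasurable
    (by have := continuous_mulLog; fun_prop)] at h
  change ∫ z : ℝ × ℝ, (f (ouStep r z.1 z.2) * Real.log (ouMean v r f z.1) + f (ouStep r z.1 z.2) -
    Real.exp (Real.log (ouMean v r f z.1)) - r ^ 2 * mulLog (f (ouStep r z.1 z.2))) ∂(G.prod G) ≤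
      _ at h
  have hfint : Integrable f G := Integrable.of_bound hf.aestronglyMeasurable b
    (Eventually.of_forall fun x => by
      rw [Real.norm_of_nonneg (ha.le.trans (hab _).1)]; exact (hab _).2)
  have hPi : Integrable (ouMean v r f) G := Integrable.of_bound hPc.aestronglyMeasurable b
    (Eventually.of_forall fun x => by
      rw [Real.norm_of_nonneg (hPpos x).le]; exact (hP x).2)
  have i2 : Integrable (fun z : ℝ × ℝ => f (ouStep r z.1 z.2)) (G.prod G) :=
    hmp.integrable_comp_of_integrable hfint
  have i4 : Integrable (fun z : ℝ × ℝ => mulLog (f (ouStep r z.1 z.2))) (G.prod G) :=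
    hmp.integrable_comp_of_integrable hmli
  have i3 : Integrable (fun z : ℝ × ℝ => ouMean v r f z.1) (G.prod G) := hPi.comp_fst G
  have i1 : Integrable (fun z : ℝ × ℝ => f (ouStep r z.1 z.2) * Real.log (ouMean v r f z.1))
      (G.prod G) := by
    refine i2.mul_bdd (c := |Real.log a| + |Real.log b|) ?_
      (Eventually.of_forall fun z => hlogb _ (hP z.1))
    exact ((hPc.log fun x => (hPpos x).ne').comp continuous_fst).aestronglyMeasurable
  simp only [Real.exp_log (hPpos _)] at h
  have i12 : Integrable (fun z : ℝ × ℝ => f (ouStep r z.1 z.2) * Real.log (ouMean v r f z.1) +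
      f (ouStep r z.1 z.2)) (G.prod G) := i1.add i2
  have i123 : Integrable (fun z : ℝ × ℝ => f (ouStep r z.1 z.2) * Real.log (ouMean v r f z.1) +
      f (ouStep r z.1 z.2) - ouMean v r f z.1) (G.prod G) := i12.sub i3
  rw [integral_sub i123 (i4.const_mul _), integral_sub i12 i3, integral_add i1 i2,
    integral_const_mul, integral_comp_measurePreserving hmp hf.aestronglyMeasurable,
    integral_comp_measurePreserving hmp hmlc.aestronglyMeasurable, integral_prod _ i1,
    integral_prod _ i3] at h
  -- With the optimal `φ`, the term `exp φ` is the average of `f`, so its integral cancels that of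
  -- `f`.
  have e2 : ∫ x, ouMean v r f x ∂G = ∫ x, f x ∂G := by
    rw [← integral_comp_measurePreserving hmp hf.aestronglyMeasurable, integral_prod _ i2]
    rfl
  simp only [integral_mul_const, integral_const, probReal_univ, one_smul, e2] at h
  change ∫ x, mulLog (ouMean v r f x) ∂G + _ - _ - _ ≤ _ at h
  linarith

/-- The dual form of the entropy contraction inequality for a function `f`. -/
def DualContraction (v : ℝ≥0) (r : ℝ) (f : ℝ → ℝ) : Prop :=
  ∀ φ : ℝ → ℝ, Measurable φ → ∀ C : ℝ, (∀ x, |φ x| ≤ C) →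
    ∫ z : ℝ × ℝ, f (ouStep r z.1 z.2) * φ z.1 ∂((gaussianReal 0 v).prod (gaussianReal 0 v)) +
        ∫ x, f x ∂(gaussianReal 0 v) - ∫ x, Real.exp (φ x) ∂(gaussianReal 0 v) ≤
      r ^ 2 * ∫ x, mulLog (f x) ∂(gaussianReal 0 v) +
        (1 - r ^ 2) * mulLog (∫ x, f x ∂(gaussianReal 0 v))

lemma integrable_ouStep_mul {v : ℝ≥0} {r : ℝ} (hr : |r| ≤ 1) {f : ℝ → ℝ}
    (hf : Integrable f (gaussianReal 0 v)) {φ : ℝ → ℝ} (hφ : Measurable φ) {C : ℝ}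
    (hC : ∀ x, |φ x| ≤ C) :
    Integrable (fun z : ℝ × ℝ => f (ouStep r z.1 z.2) * φ z.1)
      ((gaussianReal 0 v).prod (gaussianReal 0 v)) :=
  ((measurePreserving_ouStep v hr).integrable_comp_of_integrable hf).mul_bdd (c := C)
    (hφ.comp measurable_fst).aestronglyMeasurable (Eventually.of_forall fun z => hC z.1)

lemma integral_ouStep_mul {v : ℝ≥0} {r : ℝ} (hr : |r| ≤ 1) {f : ℝ → ℝ}
    (hf : Integrable f (gaussianReal 0 v)) {φ : ℝ → ℝ} (hφ : Measurable φ) {C : ℝ}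
    (hC : ∀ x, |φ x| ≤ C) :
    ∫ z : ℝ × ℝ, f (ouStep r z.1 z.2) * φ z.1 ∂((gaussianReal 0 v).prod (gaussianReal 0 v)) =
      ∫ x, ouMean v r f x * φ x ∂(gaussianReal 0 v) := by
  rw [integral_prod _ (integrable_ouStep_mul hr hf hφ hC)]
  simp only [integral_mul_const]
  rfl

lemma integrable_exp_of_abs_le {α : Type*} [MeasurableSpace α] {μ : Measure α} [IsFiniteMeasure μ]
    {φ : α → ℝ} (hφ : Measurable φ) {C : ℝ} (hC : ∀ x, |φ x| ≤ C) :
    Integrable (fun x => Real.exp (φ x)) μ :=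
  Integrable.of_bound hφ.exp.aestronglyMeasurable (Real.exp C) (Eventually.of_forall fun x => by
    rw [Real.norm_eq_abs, Real.abs_exp]; exact Real.exp_le_exp.2 ((le_abs_self _).trans (hC x)))

lemma integrable_ouMean {v : ℝ≥0} {r : ℝ} (hr : |r| ≤ 1) {f : ℝ → ℝ}
    (hf : Integrable f (gaussianReal 0 v)) : Integrable (ouMean v r f) (gaussianReal 0 v) :=
  ((measurePreserving_ouStep v hr).integrable_comp_of_integrable hf).integral_prod_left

lemma integral_ouMean {v : ℝ≥0} {r : ℝ} (hr : |r| ≤ 1) {f : ℝ → ℝ}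
    (hf : Integrable f (gaussianReal 0 v)) :
    ∫ x, ouMean v r f x ∂(gaussianReal 0 v) = ∫ x, f x ∂(gaussianReal 0 v) := by
  have hmp := measurePreserving_ouStep v hr
  rw [← integral_comp_measurePreserving hmp hf.aestronglyMeasurable]
  exact (integral_prod _ (hmp.integrable_comp_of_integrable hf)).symm

/-- The inequality is put back into dual form, now with merely measurable bounded `φ`. In this form
the approximation of `f` is easy, as the left side depends linearly on `f` apart from a constant. -/
lemma dualContraction_of_continuous (v : ℝ≥0) {r : ℝ} (hr : |r| ≤ 1) {f : ℝ → ℝ}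
    (hf : Continuous f) {a b : ℝ} (ha : 0 < a) (hab : ∀ x, f x ∈ Set.Icc a b) :
    DualContraction v r f := by
  intro φ hφ C hC
  have hb : ∀ x, ‖f x‖ ≤ b := fun x => by
    rw [Real.norm_of_nonneg (ha.le.trans (hab _).1)]; exact (hab _).2
  have hfint : Integrable f (gaussianReal 0 v) :=
    Integrable.of_bound hf.aestronglyMeasurable b (Eventually.of_forall hb)
  have hmli : Integrable (fun x => mulLog (f x)) (gaussianReal 0 v) := by
    obtain ⟨B, hB⟩ := (isCompact_Icc (a := a) (b := b)).exists_bound_of_continuousOn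
      continuous_mulLog.continuousOn
    exact Integrable.of_bound (continuous_mulLog.comp hf).aestronglyMeasurable B
      (Eventually.of_forall fun x => hB _ (hab x))
  have hmp := measurePreserving_ouStep v hr
  have hPl := integrable_mulLog_integral (F := fun z : ℝ × ℝ => f (ouStep r z.1 z.2))
    (hf.measurable.comp (continuous_ouStep r).measurable) (fun z => ha.le.trans (hab _).1)
    (hmp.integrable_comp_of_integrable hfint) (hmp.integrable_comp_of_integrable hmli)
  refine le_trans ?_ (integral_mulLog_ouMean_le_of_continuous v hr hf ha hab)
  have hPi := integrable_ouMean hr hfint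
  have hPφ : Integrable (fun x => ouMean v r f x * φ x) (gaussianReal 0 v) :=
    hPi.mul_bdd (c := C) hφ.aestronglyMeasurable (Eventually.of_forall hC)
  have hexp := integrable_exp_of_abs_le (μ := gaussianReal 0 v) hφ hC
  have hadd : Integrable (fun x => ouMean v r f x * φ x + ouMean v r f x) (gaussianReal 0 v) :=
    hPφ.add hPi
  rw [integral_ouStep_mul hr hfint hφ hC, ← integral_ouMean hr hfint, ← integral_add hPφ hPi,
    ← integral_sub hadd hexp]
  refine integral_mono (hadd.sub hexp) hPl fun x => ?_
  exact mulLog_ge_linear (integral_nonneg fun w => ha.le.trans (hab _).1) _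

lemma tendsto_integral_of_tendsto_integral_abs_sub {α : Type*} [MeasurableSpace α] {μ : Measure α}
    {F : ℕ → α → ℝ} {f : α → ℝ} (hF : ∀ n, Integrable (F n) μ) (hf : Integrable f μ)
    (h : Tendsto (fun n => ∫ x, |F n x - f x| ∂μ) atTop (𝓝 0)) :
    Tendsto (fun n => ∫ x, F n x ∂μ) atTop (𝓝 (∫ x, f x ∂μ)) := by
  rw [tendsto_iff_norm_sub_tendsto_zero]
  refine squeeze_zero (fun _ => norm_nonneg _) (fun n => ?_) h
  rw [← integral_sub (hF n) hf]
  exact norm_integral_le_integral_norm _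

/-- For fixed bounded `φ` the left side is continuous in `f` for the `L¹` norm, because the step
preserves the Gaussian measure. Only the entropy of `f` needs a separate hypothesis of convergence.
-/
lemma DualContraction.of_tendsto {v : ℝ≥0} {r : ℝ} (hr : |r| ≤ 1) {F : ℕ → ℝ → ℝ} {f : ℝ → ℝ}
    (hD : ∀ n, DualContraction v r (F n)) (hF : ∀ n, Integrable (F n) (gaussianReal 0 v))
    (hf : Integrable f (gaussianReal 0 v))
    (h : Tendsto (fun n => ∫ x, |F n x - f x| ∂(gaussianReal 0 v)) atTop (𝓝 0))
    (hl : Tendsto (fun n => ∫ x, mulLog (F n x) ∂(gaussianReal 0 v)) atTop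
      (𝓝 (∫ x, mulLog (f x) ∂(gaussianReal 0 v)))) : DualContraction v r f := by
  intro φ hφ C hC
  have hmp := measurePreserving_ouStep v hr
  have hm := tendsto_integral_of_tendsto_integral_abs_sub hF hf h
  have hφl : Tendsto (fun n => ∫ z : ℝ × ℝ, F n (ouStep r z.1 z.2) * φ z.1
      ∂((gaussianReal 0 v).prod (gaussianReal 0 v))) atTop
      (𝓝 (∫ z : ℝ × ℝ, f (ouStep r z.1 z.2) * φ z.1
        ∂((gaussianReal 0 v).prod (gaussianReal 0 v)))) := by
    refine tendsto_integral_of_tendsto_integral_abs_sub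
      (fun n => integrable_ouStep_mul hr (hF n) hφ hC) (integrable_ouStep_mul hr hf hφ hC) ?_
    have h' := h.mul_const C
    rw [zero_mul] at h'
    refine squeeze_zero (fun _ => integral_nonneg fun _ => abs_nonneg _) (fun n => ?_) h'
    have hi : Integrable (fun x => |F n x - f x|) (gaussianReal 0 v) := ((hF n).sub hf).abs
    rw [← integral_comp_measurePreserving hmp hi.aestronglyMeasurable, ← integral_mul_const]
    refine integral_mono ((integrable_ouStep_mul hr (hF n) hφ hC).sub
      (integrable_ouStep_mul hr hf hφ hC)).abs
      ((hmp.integrable_comp_of_integrable hi).mul_const C) fun z => ?_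
    simp only [← sub_mul, abs_mul]
    exact mul_le_mul_of_nonneg_left (hC _) (abs_nonneg _)
  exact le_of_tendsto_of_tendsto' ((hφl.add hm).sub_const _)
    ((hl.const_mul (r ^ 2)).add (((continuous_mulLog.tendsto _).comp hm).const_mul (1 - r ^ 2)))
    fun n => hD n φ hφ C hC

/-- Truncation of `t` to `[a, b]`. -/
noncomputable def clip (a b t : ℝ) : ℝ := max a (min b t)

lemma clip_mem {a b : ℝ} (hab : a ≤ b) (t : ℝ) : clip a b t ∈ Set.Icc a b :=
  ⟨le_max_left _ _, max_le hab (min_le_left _ _)⟩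

lemma continuous_clip (a b : ℝ) : Continuous (clip a b) := by unfold clip; fun_prop

lemma clip_eq_self {a b t : ℝ} (ht : t ∈ Set.Icc a b) : clip a b t = t := by
  rw [clip, min_eq_right ht.2, max_eq_right ht.1]

lemma abs_clip_sub_clip_le (a b s t : ℝ) : |clip a b s - clip a b t| ≤ |s - t| := by
  unfold clip
  refine (abs_max_sub_max_le_max _ _ _ _).trans ?_
  rw [sub_self, abs_zero]
  refine max_le (abs_nonneg _) ((abs_min_sub_min_le_max _ _ _ _).trans ?_)
  rw [sub_self, abs_zero]
  exact max_le (abs_nonneg _) le_rfl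

lemma dualContraction_of_mem_Icc (v : ℝ≥0) {r : ℝ} (hr : |r| ≤ 1) {f : ℝ → ℝ}
    (hf : Measurable f) {a b : ℝ} (ha : 0 < a) (hab : ∀ x, f x ∈ Set.Icc a b) :
    DualContraction v r f := by
  have hle : a ≤ b := (hab 0).1.trans (hab 0).2
  have bound : ∀ {g : ℝ → ℝ}, Measurable g → (∀ x, g x ∈ Set.Icc a b) →
      Integrable g (gaussianReal 0 v) := fun hg h =>
    Integrable.of_bound hg.aestronglyMeasurable b (Eventually.of_forall fun x => by
      rw [Real.norm_of_nonneg (ha.le.trans (h x).1)]; exact (h x).2)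
  obtain ⟨B, hB⟩ := (isCompact_Icc (a := a) (b := b)).exists_bound_of_continuousOn
      continuous_mulLog.continuousOn
  have boundl : ∀ {g : ℝ → ℝ}, Measurable g → (∀ x, g x ∈ Set.Icc a b) →
      Integrable (fun x => mulLog (g x)) (gaussianReal 0 v) := fun hg h =>
    Integrable.of_bound (continuous_mulLog.measurable.comp hg).aestronglyMeasurable B
      (Eventually.of_forall fun x => hB _ (h x))
  have hex : ∀ n : ℕ, ∃ g : ℝ → ℝ, Continuous g ∧ (∀ x, g x ∈ Set.Icc a b) ∧
      ∫ x, |g x - f x| ∂(gaussianReal 0 v) ≤ 1 / ((n : ℝ) + 1) := by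
    intro n
    obtain ⟨g, hg, hgi⟩ := (bound hf hab).exists_boundedContinuous_integral_sub_le
      (Nat.one_div_pos_of_nat (α := ℝ) (n := n))
    -- Clipping is `1`-Lipschitz and fixes the values of `f`, so it keeps the `L¹` error while
    -- forcing the approximant into `[a, b]`, where `mulLog` is Lipschitz.
    refine ⟨fun x => clip a b (g x), (continuous_clip a b).comp g.continuous,
      fun x => clip_mem hle _, le_trans ?_ hg⟩
    refine integral_mono ((bound ((continuous_clip a b).comp g.continuous).measurable
      fun x => clip_mem hle _).sub (bound hf hab)).abs ((bound hf hab).sub hgi).norm fun x => ?_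
    have := abs_clip_sub_clip_le a b (g x) (f x)
    rw [clip_eq_self (hab x)] at this
    simpa [abs_sub_comm] using this
  choose g hgc hgm hg using hex
  have hlim : Tendsto (fun n => ∫ x, |g n x - f x| ∂(gaussianReal 0 v)) atTop (𝓝 0) :=
    squeeze_zero (fun _ => integral_nonneg fun _ => abs_nonneg _) hg
      tendsto_one_div_add_atTop_nhds_zero_nat
  refine DualContraction.of_tendsto hr (fun n => dualContraction_of_continuous v hr (hgc n) ha
    (hgm n)) (fun n => bound (hgc n).measurable (hgm n)) (bound hf hab) hlim ?_
  refine tendsto_integral_of_tendsto_integral_abs_sub (fun n => boundl (hgc n).measurable (hgm n))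
    (boundl hf hab) ?_
  have h' := hlim.const_mul (1 + |Real.log a| + |Real.log b|)
  rw [mul_zero] at h'
  refine squeeze_zero (fun _ => integral_nonneg fun _ => abs_nonneg _) (fun n => ?_) h'
  rw [← integral_const_mul]
  exact integral_mono ((boundl (hgc n).measurable (hgm n)).sub (boundl hf hab)).abs
    (((bound (hgc n).measurable (hgm n)).sub (bound hf hab)).abs.const_mul _)
    fun x => abs_mulLog_sub_le ha (hgm n x) (hab x)

lemma tendsto_clip {t : ℝ} (ht : 0 ≤ t) :
    Tendsto (fun n : ℕ => clip (1 / ((n : ℝ) + 1)) (n + 1) t) atTop (𝓝 t) := by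
  have h : Tendsto (fun n : ℕ => max (1 / ((n : ℝ) + 1)) t) atTop (𝓝 (max 0 t)) :=
    tendsto_one_div_add_atTop_nhds_zero_nat.max tendsto_const_nhds
  rw [max_eq_right ht] at h
  refine h.congr' ?_
  filter_upwards [(tendsto_natCast_atTop_atTop (R := ℝ)).eventually_ge_atTop t] with n hn
  rw [clip, min_eq_right (by linarith)]

/-- Since `a ≤ 1 ≤ b`, clipping moves `t` towards `1` and cannot increase `|log t|` when `t > 0`.
The three bounds are the dominations used when the truncation is removed. -/
lemma clip_bounds {a b t : ℝ} (ha : 0 < a) (ha1 : a ≤ 1) (hb : 1 ≤ b) (ht : 0 ≤ t) :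
    |clip a b t - t| ≤ t + 1 ∧ |mulLog (clip a b t)| ≤ |mulLog t| + 1 ∧
      |t * Real.log (clip a b t)| ≤ |mulLog t| := by
  rcases le_total t a with h | h
  · have e : clip a b t = a := by rw [clip, min_eq_right (by linarith), max_eq_left h]
    have hla : Real.log a ≤ 0 := Real.log_nonpos ha.le ha1
    rw [e]
    refine ⟨abs_le.2 ⟨by linarith, by linarith⟩, ?_, ?_⟩
    · have h1 := neg_one_le_mulLog ha.le
      have h2 : mulLog a ≤ 0 := mul_nonpos_of_nonneg_of_nonpos ha.le hla
      rw [abs_of_nonpos h2]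
      linarith [abs_nonneg (mulLog t)]
    · rcases ht.eq_or_lt with rfl | ht
      · simp
      · rw [mulLog, abs_mul, abs_mul]
        refine mul_le_mul_of_nonneg_left ?_ (abs_nonneg _)
        have := Real.log_le_log ht h
        rw [abs_of_nonpos hla, abs_of_nonpos (this.trans hla)]
        linarith
  · rcases le_total t b with h' | h'
    · rw [clip_eq_self ⟨h, h'⟩]
      refine ⟨by simp; linarith, by linarith, le_rfl⟩
    · have e : clip a b t = b := by rw [clip, min_eq_left h', max_eq_right (by linarith)]
      have hlb := Real.log_nonneg hb
      have hlt := Real.log_le_log (by linarith) h'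
      have hmt : 0 ≤ mulLog t := mul_nonneg ht (hlb.trans hlt)
      rw [e]
      refine ⟨abs_le.2 ⟨by linarith, by linarith⟩, ?_, ?_⟩
      · rw [abs_of_nonneg hmt, abs_of_nonneg (show 0 ≤ mulLog b from mul_nonneg (by linarith) hlb)]
        have : mulLog b ≤ mulLog t := mul_le_mul h' hlt hlb ht
        linarith
      · rw [abs_of_nonneg hmt, abs_of_nonneg (mul_nonneg ht hlb)]
        exact mul_le_mul_of_nonneg_left hlt ht

lemma one_div_natCast_succ_bounds (n : ℕ) :
    0 < 1 / ((n : ℝ) + 1) ∧ 1 / ((n : ℝ) + 1) ≤ 1 ∧ 1 ≤ (n : ℝ) + 1 := by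
  have h : (0 : ℝ) ≤ n := Nat.cast_nonneg n
  refine ⟨by positivity, ?_, by linarith⟩
  rw [div_le_one (by positivity)]
  linarith

lemma dualContraction_of_integrable (v : ℝ≥0) {r : ℝ} (hr : |r| ≤ 1) {f : ℝ → ℝ}
    (hf : Measurable f) (h0 : ∀ x, 0 ≤ f x) (hi : Integrable f (gaussianReal 0 v))
    (hl : Integrable (fun x => mulLog (f x)) (gaussianReal 0 v)) : DualContraction v r f := by
  have hb := one_div_natCast_succ_bounds
  have hcm : ∀ n : ℕ, Measurable fun x => clip (1 / ((n : ℝ) + 1)) (n + 1) (f x) := fun n =>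
    (continuous_clip _ _).measurable.comp hf
  have hci : ∀ n : ℕ, Integrable (fun x => clip (1 / ((n : ℝ) + 1)) (n + 1) (f x))
      (gaussianReal 0 v) := fun n => Integrable.of_bound (hcm n).aestronglyMeasurable (n + 1)
    (Eventually.of_forall fun x => by
      have := clip_mem ((hb n).2.1.trans (hb n).2.2) (f x)
      rw [Real.norm_of_nonneg ((hb n).1.le.trans this.1)]
      exact this.2)
  refine DualContraction.of_tendsto hr
    (F := fun n x => clip (1 / ((n : ℝ) + 1)) (n + 1) (f x))
    (fun n => dualContraction_of_mem_Icc v hr (hcm n) (hb n).1 fun x =>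
      clip_mem ((hb n).2.1.trans (hb n).2.2) _) hci hi ?_ ?_
  · have hz : ∫ _ : ℝ, (0 : ℝ) ∂(gaussianReal 0 v) = 0 := integral_zero ℝ ℝ
    rw [← congrArg 𝓝 hz]
    refine tendsto_integral_of_dominated_convergence (fun x => f x + 1)
      (F := fun n x => |clip (1 / ((n : ℝ) + 1)) (n + 1) (f x) - f x|)
      (fun n => ((hcm n).sub hf).abs.aestronglyMeasurable) (hi.add (integrable_const 1))
      (fun n => Eventually.of_forall fun x => ?_) (Eventually.of_forall fun x => ?_)
    · rw [Real.norm_eq_abs, abs_abs]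
      exact (clip_bounds (hb n).1 (hb n).2.1 (hb n).2.2 (h0 x)).1
    · simpa using ((tendsto_clip (h0 x)).sub_const (f x)).abs
  · refine tendsto_integral_of_dominated_convergence (fun x => |mulLog (f x)| + 1)
      (fun n => (continuous_mulLog.measurable.comp (hcm n)).aestronglyMeasurable)
      (hl.abs.add (integrable_const 1))
      (fun n => Eventually.of_forall fun x =>
        (clip_bounds (hb n).1 (hb n).2.1 (hb n).2.2 (h0 x)).2.1)
      (Eventually.of_forall fun x => (continuous_mulLog.tendsto _).comp (tendsto_clip (h0 x)))

/-- Contraction of entropy under the one-dimensional Ornstein-Uhlenbeck step. -/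
theorem integral_mulLog_ouMean_le (v : ℝ≥0) {r : ℝ} (hr : |r| ≤ 1) {f : ℝ → ℝ}
    (hf : Measurable f) (h0 : ∀ x, 0 ≤ f x) (hi : Integrable f (gaussianReal 0 v))
    (hl : Integrable (fun x => mulLog (f x)) (gaussianReal 0 v)) :
    ∫ x, mulLog (ouMean v r f x) ∂(gaussianReal 0 v) ≤
      r ^ 2 * ∫ x, mulLog (f x) ∂(gaussianReal 0 v) +
        (1 - r ^ 2) * mulLog (∫ x, f x ∂(gaussianReal 0 v)) := by
  have hD := dualContraction_of_integrable v hr hf h0 hi hl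
  have hb := one_div_natCast_succ_bounds
  have hmp := measurePreserving_ouStep v hr
  have hPl : Integrable (fun x => mulLog (ouMean v r f x)) (gaussianReal 0 v) :=
    integrable_mulLog_integral (F := fun z : ℝ × ℝ => f (ouStep r z.1 z.2))
    (hf.comp (continuous_ouStep r).measurable) (fun z => h0 _)
    (hmp.integrable_comp_of_integrable hi) (hmp.integrable_comp_of_integrable hl)
  have hP0 : ∀ x, 0 ≤ ouMean v r f x := fun x => integral_nonneg fun w => h0 _
  have hPm : Measurable (ouMean v r f) :=
    ((hf.comp (continuous_ouStep r).measurable).stronglyMeasurable.integral_prod_right').measurable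
  have hPi := integrable_ouMean hr hi
  set P := ouMean v r f
  -- The optimal choice `log P` may be unbounded, so `P` is truncated before taking the logarithm;
  -- dominated convergence then recovers `P log P`.
  set c : ℕ → ℝ → ℝ := fun (n : ℕ) (x : ℝ) => clip (1 / ((n : ℝ) + 1)) (n + 1) (P x)
  have hcm : ∀ n, Measurable (c n) := fun n => (continuous_clip _ _).measurable.comp hPm
  have hcmem : ∀ (n : ℕ) (x : ℝ), c n x ∈ Set.Icc (1 / ((n : ℝ) + 1)) ((n : ℝ) + 1) := fun n x =>
    clip_mem ((hb n).2.1.trans (hb n).2.2) _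
  have hcpos : ∀ n x, 0 < c n x := fun n x => (hb n).1.trans_le (hcmem n x).1
  have hφC : ∀ (n : ℕ) (x : ℝ), |Real.log (c n x)| ≤
      |Real.log (1 / ((n : ℝ) + 1))| + |Real.log ((n : ℝ) + 1)| := by
    intro n x
    have h1 := Real.log_le_log (hb n).1 (hcmem n x).1
    have h2 := Real.log_le_log (hcpos n x) (hcmem n x).2
    rw [abs_le]
    constructor <;> linarith [neg_abs_le (Real.log (1 / ((n : ℝ) + 1))),
      le_abs_self (Real.log ((n : ℝ) + 1)), abs_nonneg (Real.log (1 / ((n : ℝ) + 1))),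
      abs_nonneg (Real.log ((n : ℝ) + 1))]
  have hineq := fun n => hD (fun x => Real.log (c n x)) (hcm n).log _ (hφC n)
  simp only [integral_ouStep_mul hr hi (hcm _).log (hφC _), Real.exp_log (hcpos _ _)] at hineq
  have l1 : Tendsto (fun n => ∫ x, P x * Real.log (c n x) ∂(gaussianReal 0 v)) atTop
      (𝓝 (∫ x, mulLog (P x) ∂(gaussianReal 0 v))) := by
    refine tendsto_integral_of_dominated_convergence (fun x => |mulLog (P x)|)
      (fun n => (hPm.mul (hcm n).log).aestronglyMeasurable) hPl.abs
      (fun n => Eventually.of_forall fun x =>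
        (clip_bounds (hb n).1 (hb n).2.1 (hb n).2.2 (hP0 x)).2.2)
      (Eventually.of_forall fun x => ?_)
    rcases (hP0 x).eq_or_lt with h | h
    · simp [mulLog, ← h]
    · exact ((Real.continuousAt_log h.ne').tendsto.comp (tendsto_clip h.le)).const_mul _
  have l2 : Tendsto (fun n => ∫ x, c n x ∂(gaussianReal 0 v)) atTop
      (𝓝 (∫ x, f x ∂(gaussianReal 0 v))) := by
    rw [← integral_ouMean hr hi]
    refine tendsto_integral_of_dominated_convergence (fun x => P x + 1)
      (fun n => (hcm n).aestronglyMeasurable) (hPi.add (integrable_const 1))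
      (fun n => Eventually.of_forall fun x => ?_)
      (Eventually.of_forall fun x => tendsto_clip (hP0 x))
    rw [Real.norm_of_nonneg (hcpos n x).le]
    refine max_le ?_ ((min_le_right _ _).trans ?_) <;> linarith [hP0 x, (hb n).2.1]
  have := le_of_tendsto' ((l1.add_const (∫ x, f x ∂(gaussianReal 0 v))).sub l2) hineq
  simpa using this

/-! ### Expansion over subsets of coordinates -/

/-- Induction on the set `s` of coordinates already replaced: those in `σ` have become `0`, the rest
of `s` has become `1`. A new coordinate still carries its own `γ i`, and the hypothesis splits each
term in two; the weights are nonnegative, so the bounds add up. -/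
lemma le_sum_powerset_of_coordinatewise {ι : Type*} [DecidableEq ι] {γ : ι → ℝ}
    {Φ : (ι → ℝ) → ℝ}
    (hΦ : ∀ γ : ι → ℝ, (∀ i, |γ i| ≤ 1) → ∀ i, Φ γ ≤ γ i ^ 2 * Φ (Function.update γ i 1) +
      (1 - γ i ^ 2) * Φ (Function.update γ i 0)) (hγ : ∀ i, |γ i| ≤ 1) (s : Finset ι) :
    Φ γ ≤ ∑ σ ∈ s.powerset, (∏ i ∈ s \ σ, γ i ^ 2) * (∏ j ∈ σ, (1 - γ j ^ 2)) *
      Φ (fun i => if i ∈ σ then 0 else if i ∈ s then 1 else γ i) := by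
  induction s using Finset.induction_on with
  | empty => simp
  | insert i s hi ih =>
    refine ih.trans ?_
    rw [Finset.sum_powerset_insert hi, ← Finset.sum_add_distrib]
    refine Finset.sum_le_sum fun σ hσ => ?_
    have hσs : σ ⊆ s := Finset.mem_powerset.1 hσ
    have hiσ : i ∉ σ := fun h => hi (hσs h)
    have hsq : ∀ j, 0 ≤ 1 - γ j ^ 2 := fun j =>
      sub_nonneg.2 ((sq_le_one_iff_abs_le_one _).2 (hγ j))
    have hstep := hΦ (fun j => if j ∈ σ then 0 else if j ∈ s then 1 else γ j) (fun j => by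
      by_cases h1 : j ∈ σ <;> by_cases h2 : j ∈ s <;> simp [h1, h2, hγ j]) i
    have e1 : Function.update (fun j => if j ∈ σ then 0 else if j ∈ s then 1 else γ j) i 1 =
        fun j => if j ∈ σ then 0 else if j ∈ insert i s then 1 else γ j := by
      funext j
      by_cases hj : j = i
      · subst hj; simp [hiσ]
      · simp [hj]
    have e0 : Function.update (fun j => if j ∈ σ then 0 else if j ∈ s then 1 else γ j) i 0 =
        fun j => if j ∈ insert i σ then 0 else if j ∈ insert i s then 1 else γ j := by
      funext j
      by_cases hj : j = i
      · subst hj; simp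
      · simp [hj]
    rw [e1, e0] at hstep
    simp only [hiσ, hi, if_false] at hstep
    rw [Finset.insert_sdiff_of_notMem _ hiσ,
      Finset.prod_insert (fun h => hi (Finset.mem_sdiff.1 h).1),
      Finset.insert_sdiff_insert, Finset.sdiff_insert_of_notMem hi, Finset.prod_insert hiσ]
    have hw : 0 ≤ (∏ i ∈ s \ σ, γ i ^ 2) * (∏ j ∈ σ, (1 - γ j ^ 2)) :=
      mul_nonneg (Finset.prod_nonneg fun j _ => sq_nonneg _) (Finset.prod_nonneg fun j _ => hsq j)
    refine (mul_le_mul_of_nonneg_left hstep hw).trans_eq ?_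
    ring

/-! ### The bound for product Gaussian measures -/

section Pi

variable {ι : Type*}

/-- The product of centered Gaussian measures of variance `v`. -/
noncomputable def gaussPi (ι : Type*) [Fintype ι] (v : ℝ≥0) : Measure (ι → ℝ) :=
  Measure.pi fun _ => gaussianReal 0 v

instance [Fintype ι] (v : ℝ≥0) : IsProbabilityMeasure (gaussPi ι v) := by
  unfold gaussPi; infer_instance

/-- The vector with coordinates `γ i * x i + √(1 - γ i ^ 2) * w i`. -/
noncomputable def ouVec (γ x w : ι → ℝ) : ι → ℝ := fun i => ouStep (γ i) (x i) (w i)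

lemma measurable_ouVec (γ : ι → ℝ) : Measurable fun z : (ι → ℝ) × (ι → ℝ) => ouVec γ z.1 z.2 := by
  unfold ouVec ouStep; fun_prop

lemma measurePreserving_ouVec [Fintype ι] (v : ℝ≥0) {γ : ι → ℝ} (hγ : ∀ i, |γ i| ≤ 1) :
    MeasurePreserving (fun z : (ι → ℝ) × (ι → ℝ) => ouVec γ z.1 z.2)
      ((gaussPi ι v).prod (gaussPi ι v)) (gaussPi ι v) :=
  (measurePreserving_pi (fun _ : ι => (gaussianReal 0 v).prod (gaussianReal 0 v))
    (fun _ => gaussianReal 0 v) fun i => measurePreserving_ouStep v (hγ i)).comp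
    (measurePreserving_arrowProdEquivProdArrow ℝ ℝ ι (fun _ => gaussianReal 0 v)
      (fun _ => gaussianReal 0 v)).symm

lemma measurable_update_pair [DecidableEq ι] (i : ι) :
    Measurable fun z : (ι → ℝ) × ℝ => Function.update z.1 i z.2 := by
  refine measurable_pi_iff.2 fun j => ?_
  by_cases h : j = i
  · subst h; simpa using measurable_snd
  · simp only [Function.update_of_ne h]; fun_prop

lemma measurePreserving_update_pair [Fintype ι] [DecidableEq ι] (v : ℝ≥0) (i : ι) :
    MeasurePreserving (fun z : (ι → ℝ) × ℝ => Function.update z.1 i z.2)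
      ((gaussPi ι v).prod (gaussianReal 0 v)) (gaussPi ι v) := by
  refine ⟨measurable_update_pair i, (Measure.pi_eq fun s hs => ?_).symm⟩
  rw [Measure.map_apply (measurable_update_pair i) (MeasurableSet.univ_pi hs)]
  have : (fun z : (ι → ℝ) × ℝ => Function.update z.1 i z.2) ⁻¹' Set.univ.pi s =
      (Set.univ.pi (Function.update s i Set.univ)) ×ˢ s i := by
    ext z
    simp only [Set.mem_preimage, Set.mem_pi, Set.mem_univ, true_imp_iff, Set.mem_prod]
    constructor
    · refine fun h => ⟨fun j => ?_, by simpa using h i⟩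
      by_cases hj : j = i
      · subst hj; simp
      · simpa [hj] using h j
    · rintro ⟨h, h'⟩ j
      by_cases hj : j = i
      · subst hj; simpa using h'
      · simpa [hj] using h j
  rw [this, Measure.prod_prod, gaussPi, Measure.pi_pi,
    ← Finset.mul_prod_erase _ _ (Finset.mem_univ i),
    ← Finset.mul_prod_erase _ (fun j => gaussianReal 0 v (s j)) (Finset.mem_univ i)]
  simp only [Function.update_self, measure_univ, one_mul]
  rw [mul_comm]
  congr 1
  refine Finset.prod_congr rfl fun j hj => ?_
  rw [Function.update_of_ne (Finset.ne_of_mem_erase hj)]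

/-- The average of `h` over `ouVec γ x w`, for Gaussian `w`. -/
noncomputable def ouAvg [Fintype ι] (v : ℝ≥0) (γ : ι → ℝ) (h : (ι → ℝ) → ℝ) (x : ι → ℝ) : ℝ :=
  ∫ w, h (ouVec γ x w) ∂(gaussPi ι v)

variable {v : ℝ≥0} {γ : ι → ℝ} {h : (ι → ℝ) → ℝ}

lemma measurable_ouAvg [Fintype ι] (hm : Measurable h) : Measurable (ouAvg v γ h) :=
  ((hm.comp (measurable_ouVec γ)).stronglyMeasurable.integral_prod_right').measurable

lemma ouAvg_nonneg [Fintype ι] (h0 : ∀ x, 0 ≤ h x) (x : ι → ℝ) : 0 ≤ ouAvg v γ h x :=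
  integral_nonneg fun _ => h0 _

lemma integrable_ouAvg [Fintype ι] (hγ : ∀ i, |γ i| ≤ 1) (hi : Integrable h (gaussPi ι v)) :
    Integrable (ouAvg v γ h) (gaussPi ι v) :=
  ((measurePreserving_ouVec v hγ).integrable_comp_of_integrable hi).integral_prod_left

lemma integrable_mulLog_ouAvg [Fintype ι] (hγ : ∀ i, |γ i| ≤ 1) (hm : Measurable h)
    (h0 : ∀ x, 0 ≤ h x)
    (hi : Integrable h (gaussPi ι v)) (hl : Integrable (fun x => mulLog (h x)) (gaussPi ι v)) :
    Integrable (fun x => mulLog (ouAvg v γ h x)) (gaussPi ι v) :=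
  integrable_mulLog_integral (F := fun z : (ι → ℝ) × (ι → ℝ) => h (ouVec γ z.1 z.2))
    (hm.comp (measurable_ouVec γ)) (fun _ => h0 _)
    ((measurePreserving_ouVec v hγ).integrable_comp_of_integrable hi)
    ((measurePreserving_ouVec v hγ).integrable_comp_of_integrable hl)

/-- At coefficient `1` the noise has factor `√(1 - 1) = 0`, so the noise in coordinate `i` can be
applied first, to `x` alone. This is what isolates one coordinate of the average. -/
lemma ouVec_update [DecidableEq ι] (γ x w : ι → ℝ) (i : ι) (u : ℝ) :
    ouVec γ x (Function.update w i u) =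
      ouVec (Function.update γ i 1) (Function.update x i (ouStep (γ i) (x i) u)) w := by
  funext j
  by_cases hj : j = i
  · subst hj; simp [ouVec, ouStep]
  · simp [ouVec, hj]

/-- The average factors through the average in the `i`-th coordinate. -/
lemma ouAvg_ae_eq [Fintype ι] [DecidableEq ι] (hγ : ∀ i, |γ i| ≤ 1)
    (hi : Integrable h (gaussPi ι v)) (i : ι) :
    ∀ᵐ x ∂(gaussPi ι v), ouAvg v γ h x =
      ∫ u, ouAvg v (Function.update γ i 1) h (Function.update x i (ouStep (γ i) (x i) u))
        ∂(gaussianReal 0 v) := by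
  filter_upwards [((measurePreserving_ouVec v hγ).integrable_comp_of_integrable hi).prod_right_ae]
    with x hx
  change Integrable (fun w => h (ouVec γ x w)) _ at hx
  have hmp := measurePreserving_update_pair v i
  unfold ouAvg
  simp only [← ouVec_update]
  rw [← integral_comp_measurePreserving hmp hx.aestronglyMeasurable]
  exact integral_prod_symm _ (hmp.integrable_comp_of_integrable hx)

/-- Contraction of entropy in one coordinate. -/
lemma integral_mulLog_update_le [Fintype ι] [DecidableEq ι] {f : (ι → ℝ) → ℝ}
    (hf : Measurable f) (h0 : ∀ x, 0 ≤ f x)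
    (hi : Integrable f (gaussPi ι v)) (hl : Integrable (fun x => mulLog (f x)) (gaussPi ι v))
    (i : ι) {r : ℝ} (hr : |r| ≤ 1)
    (hT : Integrable (fun x => mulLog (∫ u, f (Function.update x i (ouStep r (x i) u))
      ∂(gaussianReal 0 v))) (gaussPi ι v)) :
    ∫ x, mulLog (∫ u, f (Function.update x i (ouStep r (x i) u)) ∂(gaussianReal 0 v))
        ∂(gaussPi ι v) ≤
      r ^ 2 * ∫ x, mulLog (f x) ∂(gaussPi ι v) + (1 - r ^ 2) *
        ∫ x, mulLog (∫ u, f (Function.update x i u) ∂(gaussianReal 0 v)) ∂(gaussPi ι v) := by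
  have hmp := measurePreserving_update_pair v i
  have hi' := hmp.integrable_comp_of_integrable hi
  have hl' := hmp.integrable_comp_of_integrable hl
  have hT' := hmp.integrable_comp_of_integrable hT
  have hE := integrable_mulLog_integral
    (F := fun z : (ι → ℝ) × ℝ => f (Function.update z.1 i z.2))
    (hf.comp (measurable_update_pair i)) (fun _ => h0 _) hi' hl'
  -- Resampling coordinate `i` preserves the measure. It splits off an integral over that
  -- coordinate, to which the one-dimensional inequality applies for almost every value of the
  -- others.
  rw [← integral_comp_measurePreserving hmp hT.aestronglyMeasurable,
    ← integral_comp_measurePreserving hmp hl.aestronglyMeasurable]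
  refine (integral_prod _ hT').trans_le ?_
  refine le_of_le_of_eq ?_ (congrArg (fun t => r ^ 2 * t + _) (integral_prod _ hl').symm)
  rw [← integral_const_mul, ← integral_const_mul, ← integral_add
    (hl'.integral_prod_left.const_mul _) (hE.const_mul _)]
  refine integral_mono_ae hT'.integral_prod_left
    ((hl'.integral_prod_left.const_mul _).add (hE.const_mul _)) ?_
  filter_upwards [hi'.prod_right_ae, hl'.prod_right_ae] with x hx hlx
  have := integral_mulLog_ouMean_le v hr (f := fun t => f (Function.update x i t))
    (hf.comp (measurable_update x)) (fun _ => h0 _) hx hlx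
  simpa [ouMean] using this

lemma abs_update_le [DecidableEq ι] (hγ : ∀ i, |γ i| ≤ 1) (i : ι) {t : ℝ} (ht : |t| ≤ 1) (j : ι) :
    |Function.update γ i t j| ≤ 1 := by
  by_cases hj : j = i
  · subst hj; simpa using ht
  · simpa [hj] using hγ j

lemma integral_mulLog_ouAvg_le [Fintype ι] [DecidableEq ι]
    (hγ : ∀ i, |γ i| ≤ 1) (hm : Measurable h)
    (h0 : ∀ x, 0 ≤ h x)
    (hi : Integrable h (gaussPi ι v)) (hl : Integrable (fun x => mulLog (h x)) (gaussPi ι v))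
    (i : ι) :
    ∫ x, mulLog (ouAvg v γ h x) ∂(gaussPi ι v) ≤
      γ i ^ 2 * ∫ x, mulLog (ouAvg v (Function.update γ i 1) h x) ∂(gaussPi ι v) +
      (1 - γ i ^ 2) * ∫ x, mulLog (ouAvg v (Function.update γ i 0) h x) ∂(gaussPi ι v) := by
  have hγ1 := abs_update_le hγ i (t := 1) (by simp)
  have hγ0 := abs_update_le hγ i (t := 0) (by simp)
  have e := ouAvg_ae_eq hγ hi i
  -- At coefficient `0` the step from any point is `u` itself, so this describes complete averaging
  -- in coordinate `i`, the last term of the one-coordinate inequality.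
  have e0 := ouAvg_ae_eq hγ0 hi i
  simp only [Function.update_self, Function.update_idem] at e0
  have hT := (integrable_mulLog_ouAvg hγ hm h0 hi hl).congr
    (e.mono fun x hx => congrArg mulLog hx)
  have := integral_mulLog_update_le (measurable_ouAvg hm) (ouAvg_nonneg h0)
    (integrable_ouAvg hγ1 hi) (integrable_mulLog_ouAvg hγ1 hm h0 hi hl) i (hγ i) hT
  rw [integral_congr_ae (e.mono fun x hx => congrArg mulLog hx),
    integral_congr_ae (e0.mono fun x hx => congrArg mulLog hx)]
  refine this.trans_eq ?_
  simp [ouStep]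

/-- The partial entropy bound for product Gaussian measures. -/
theorem integral_mulLog_ouAvg_le_sum [Fintype ι] [DecidableEq ι] (hγ : ∀ i, |γ i| ≤ 1)
    (hm : Measurable h)
    (h0 : ∀ x, 0 ≤ h x) (hi : Integrable h (gaussPi ι v))
    (hl : Integrable (fun x => mulLog (h x)) (gaussPi ι v)) :
    ∫ x, mulLog (ouAvg v γ h x) ∂(gaussPi ι v) ≤
      ∑ σ : Finset ι, (∏ i ∈ σᶜ, γ i ^ 2) * (∏ j ∈ σ, (1 - γ j ^ 2)) *
        ∫ x, mulLog (ouAvg v (fun i => if i ∈ σ then 0 else 1) h x) ∂(gaussPi ι v) := by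
  have := le_sum_powerset_of_coordinatewise
    (Φ := fun γ => ∫ x, mulLog (ouAvg v γ h x) ∂(gaussPi ι v))
    (fun γ hγ i => integral_mulLog_ouAvg_le hγ hm h0 hi hl i) hγ Finset.univ
  simpa only [Finset.powerset_univ, Finset.mem_univ, if_true, ← Finset.compl_eq_univ_sdiff]
    using this

end Pi

/-! ### The Gaussian measure on Euclidean space -/

/-- The variance of the density `exp (-π x ^ 2)`. -/
noncomputable def gaussVar : ℝ≥0 := ⟨(2 * Real.pi)⁻¹, by positivity⟩

instance isFiniteMeasure_gaussMeasure {ι : Type*} [Fintype ι] :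
    IsFiniteMeasure (gaussMeasure ι) := by
  refine isFiniteMeasure_withDensity_ofReal ?_
  have h := GaussianFourier.integrable_cexp_neg_mul_sq_norm_add (V := EuclideanSpace ℝ ι)
    (b := (Real.pi : ℂ)) (by simpa using Real.pi_pos) 0 0
  refine (h.norm.congr (Eventually.of_forall fun v => ?_)).2
  simp only [Complex.norm_exp]
  congr 1
  rw [zero_mul, add_zero, ← Complex.ofReal_pow, ← Complex.ofReal_neg, ← Complex.ofReal_mul,
    Complex.ofReal_re]

lemma charFun_gaussMeasure {ι : Type*} [Fintype ι] (t : EuclideanSpace ℝ ι) :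
    charFun (gaussMeasure ι) t = Complex.exp (-‖t‖ ^ 2 / (4 * Real.pi)) := by
  have hpi : (Real.pi : ℂ) ≠ 0 := by exact_mod_cast Real.pi_ne_zero
  have h := GaussianFourier.integral_cexp_neg_mul_sq_norm_add (V := EuclideanSpace ℝ ι)
    (b := (Real.pi : ℂ)) (by simpa using Real.pi_pos) Complex.I t
  -- The prefactor is a power of `π / b`, equal to `1` at `b = π`: the measure is already
  -- normalized.
  rw [div_self hpi, Complex.one_cpow, one_mul, Complex.I_sq] at h
  rw [charFun_apply, gaussMeasure, integral_withDensity_eq_integral_toReal_smul (by fun_prop)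
    (Eventually.of_forall fun _ => ENNReal.ofReal_lt_top)]
  convert! h using 1
  · congr 1
    funext x
    rw [ENNReal.toReal_ofReal (Real.exp_pos _).le, Complex.real_smul, Complex.ofReal_exp,
      ← Complex.exp_add, real_inner_comm]
    congr 1
    push_cast
    ring
  · congr 1
    ring

lemma measurePreserving_toLp_gauss {ι : Type*} [Fintype ι] :
    MeasurePreserving (WithLp.toLp 2) (gaussPi ι gaussVar) (gaussMeasure ι) := by
  have hm : Measurable (WithLp.toLp 2 : (ι → ℝ) → EuclideanSpace ℝ ι) := by fun_prop
  refine ⟨hm, ?_⟩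
  have : IsProbabilityMeasure ((gaussPi ι gaussVar).map (WithLp.toLp 2)) :=
    Measure.isProbabilityMeasure_map hm.aemeasurable
  refine Measure.ext_of_charFun (funext fun t => ?_)
  rw [gaussPi, charFun_pi, charFun_gaussMeasure]
  simp only [charFun_gaussianReal, Complex.ofReal_zero, mul_zero, zero_mul, zero_sub]
  rw [← Complex.exp_sum]
  congr 1
  rw [← Complex.ofReal_pow, EuclideanSpace.real_norm_sq_eq, Complex.ofReal_sum,
    ← Finset.sum_neg_distrib, Finset.sum_div]
  refine Finset.sum_congr rfl fun i _ => ?_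
  have : ((gaussVar : ℝ) : ℂ) = (2 * Real.pi : ℂ)⁻¹ := by
    change (((2 * Real.pi)⁻¹ : ℝ) : ℂ) = _
    push_cast; rfl
  rw [this]
  have hpi : (Real.pi : ℂ) ≠ 0 := by exact_mod_cast Real.pi_ne_zero
  push_cast
  field_simp
  ring

instance isProbabilityMeasure_gaussMeasure {ι : Type*} [Fintype ι] :
    IsProbabilityMeasure (gaussMeasure ι) := by
  rw [← measurePreserving_toLp_gauss.map_eq]
  exact Measure.isProbabilityMeasure_map measurePreserving_toLp_gauss.measurable.aemeasurable

lemma measurePreserving_ofLp_gauss {ι : Type*} [Fintype ι] :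
    MeasurePreserving (WithLp.ofLp) (gaussMeasure ι) (gaussPi ι gaussVar) :=
  MeasurePreserving.symm (MeasurableEquiv.toLp 2 (ι → ℝ)) measurePreserving_toLp_gauss

/-! ### Invariance under rotations -/

section Rotation

variable {ι : Type*} [Fintype ι]

lemma act_act (A B : Matrix ι ι ℝ) (v : EuclideanSpace ℝ ι) : act A (act B v) = act (A * B) v := by
  simp [act, Matrix.mulVec_mulVec]

lemma act_one [DecidableEq ι] (v : EuclideanSpace ℝ ι) : act (1 : Matrix ι ι ℝ) v = v := by
  simp [act]

lemma inner_act (A : Matrix ι ι ℝ) (v w : EuclideanSpace ℝ ι) :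
    inner ℝ (act A v) w = inner ℝ v (act Aᵀ w) := by
  simp only [EuclideanSpace.inner_eq_star_dotProduct, act, star_trivial]
  rw [Matrix.mulVec_transpose, ← Matrix.dotProduct_mulVec]

lemma norm_act [DecidableEq ι] {A : Matrix ι ι ℝ} (hA : Aᵀ * A = 1) (v : EuclideanSpace ℝ ι) :
    ‖act A v‖ = ‖v‖ := by
  rw [← sq_eq_sq₀ (norm_nonneg _) (norm_nonneg _), ← real_inner_self_eq_norm_sq,
    ← real_inner_self_eq_norm_sq, inner_act, act_act, hA, act_one]

lemma measurable_act (A : Matrix ι ι ℝ) : Measurable (act A) := by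
  have : Continuous (act A) := by
    unfold act
    exact (PiLp.continuous_toLp 2 _).comp
      (continuous_const.matrix_mulVec (PiLp.continuous_ofLp 2 _))
  exact this.measurable

/-- The characteristic function depends only on the norm of its argument, which the transpose of an
orthogonal matrix preserves. -/
lemma measurePreserving_act [DecidableEq ι] {A : Matrix ι ι ℝ} (hA : A * Aᵀ = 1) :
    MeasurePreserving (act A) (gaussMeasure ι) (gaussMeasure ι) := by
  refine ⟨measurable_act A, ?_⟩
  have : IsProbabilityMeasure ((gaussMeasure ι).map (act A)) :=
    Measure.isProbabilityMeasure_map (measurable_act A).aemeasurable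
  refine Measure.ext_of_charFun (funext fun t => ?_)
  rw [charFun_apply, integral_map (measurable_act A).aemeasurable (by fun_prop)]
  simp only [inner_act]
  rw [← charFun_apply, charFun_gaussMeasure, charFun_gaussMeasure, norm_act (by simpa using hA)]

end Rotation

/-! ### Averages and marginals -/

section Marginal

variable {ι : Type*} [Fintype ι]

lemma measurePreserving_ouPoint {γ : ι → ℝ} (hγ : ∀ i, |γ i| ≤ 1) :
    MeasurePreserving (fun z : EuclideanSpace ℝ ι × EuclideanSpace ℝ ι => ouPoint γ z.1 z.2)
      ((gaussMeasure ι).prod (gaussMeasure ι)) (gaussMeasure ι) :=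
  (measurePreserving_toLp_gauss.comp (measurePreserving_ouVec gaussVar hγ)).comp
    (measurePreserving_ofLp_gauss.prod measurePreserving_ofLp_gauss)

lemma ouAverage_eq_ouAvg {k : (ι → ℝ) → ℝ} (hk : Measurable k) (γ : ι → ℝ)
    (v : EuclideanSpace ℝ ι) :
    ouAverage (fun x => k x.ofLp) γ v = ouAvg gaussVar γ k v.ofLp := by
  have hm : Measurable fun w => k (ouVec γ v.ofLp w) :=
    hk.comp ((measurable_ouVec γ).comp measurable_prodMk_left)
  exact integral_comp_measurePreserving measurePreserving_ofLp_gauss hm.aestronglyMeasurable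

/-- The points `ouPoint γ v w` are jointly Gaussian-distributed, so for almost every `v` a null set
is missed by almost every `w`. This permits replacing the given function by a measurable nonnegative
version. -/
lemma ouAverage_congr_ae {γ : ι → ℝ} (hγ : ∀ i, |γ i| ≤ 1) {f g : EuclideanSpace ℝ ι → ℝ}
    (h : f =ᵐ[gaussMeasure ι] g) : ouAverage f γ =ᵐ[gaussMeasure ι] ouAverage g γ := by
  have := Measure.ae_ae_of_ae_prod
    ((measurePreserving_ouPoint hγ).quasiMeasurePreserving.ae h)
  filter_upwards [this] with v hv
  exact integral_congr_ae hv

variable [DecidableEq ι]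

lemma measurable_glue (σ : Finset ι) :
    Measurable fun z : EuclideanSpace ℝ (σᶜ : Finset ι) × EuclideanSpace ℝ σ =>
      glue σ z.2 z.1 := by
  refine (WithLp.measurable_toLp 2 (ι → ℝ)).comp (measurable_pi_iff.2 fun i => ?_)
  by_cases hi : i ∈ σ
  · simp only [hi, dite_true]; fun_prop
  · simp only [hi, dite_false]; fun_prop

lemma measurePreserving_glue (σ : Finset ι) :
    MeasurePreserving (fun z : EuclideanSpace ℝ (σᶜ : Finset ι) × EuclideanSpace ℝ σ =>
      glue σ z.2 z.1) ((gaussMeasure (σᶜ : Finset ι)).prod (gaussMeasure σ)) (gaussMeasure ι) := by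
  let g : ((σᶜ : Finset ι) → ℝ) × (σ → ℝ) → ι → ℝ := fun z i =>
    if hi : i ∈ σ then z.2 ⟨i, hi⟩ else z.1 ⟨i, Finset.mem_compl.mpr hi⟩
  have hg : Measurable g := by
    refine measurable_pi_iff.2 fun i => ?_
    by_cases hi : i ∈ σ
    · simp only [g, hi, dite_true]; fun_prop
    · simp only [g, hi, dite_false]; fun_prop
  have hmp : MeasurePreserving g ((gaussPi (σᶜ : Finset ι) gaussVar).prod (gaussPi σ gaussVar))
      (gaussPi ι gaussVar) := by
    refine ⟨hg, (Measure.pi_eq fun s hs => ?_).symm⟩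
    rw [Measure.map_apply hg (MeasurableSet.univ_pi hs)]
    have : g ⁻¹' Set.univ.pi s = (Set.univ.pi fun i : (σᶜ : Finset ι) => s i) ×ˢ
        (Set.univ.pi fun i : σ => s i) := by
      ext z
      simp only [Set.mem_preimage, Set.mem_pi, Set.mem_univ, true_imp_iff, Set.mem_prod, g]
      constructor
      · refine fun h => ⟨fun i => ?_, fun i => ?_⟩
        · simpa [Finset.mem_compl.1 i.2] using h i
        · simpa using h i
      · rintro ⟨h, h'⟩ i
        by_cases hi : i ∈ σ
        · simpa [hi] using h' ⟨i, hi⟩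
        · simpa [hi] using h ⟨i, Finset.mem_compl.mpr hi⟩
    rw [this, Measure.prod_prod, gaussPi, gaussPi, Measure.pi_pi, Measure.pi_pi,
      Finset.prod_coe_sort σᶜ fun i => gaussianReal 0 gaussVar (s i),
      Finset.prod_coe_sort σ fun i => gaussianReal 0 gaussVar (s i), mul_comm,
      Finset.prod_mul_prod_compl]
  exact (measurePreserving_toLp_gauss.comp hmp).comp
    (measurePreserving_ofLp_gauss.prod measurePreserving_ofLp_gauss)

lemma measurable_proj {ι : Type*} (τ : Finset ι) : Measurable (proj τ) := by
  unfold proj; fun_prop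

lemma proj_glue (σ : Finset ι) (y : EuclideanSpace ℝ σ) (x : EuclideanSpace ℝ (σᶜ : Finset ι)) :
    proj σ (glue σ y x) = y := by
  ext i; simp [proj, glue]

lemma proj_compl_glue (σ : Finset ι) (y : EuclideanSpace ℝ σ)
    (x : EuclideanSpace ℝ (σᶜ : Finset ι)) : proj σᶜ (glue σ y x) = x := by
  ext i; simp [proj, glue, Finset.mem_compl.1 i.2]

lemma measurePreserving_proj (σ : Finset ι) :
    MeasurePreserving (proj σ) (gaussMeasure ι) (gaussMeasure σ) := by
  refine ⟨measurable_proj σ, ?_⟩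
  rw [← (measurePreserving_glue σ).map_eq, Measure.map_map (measurable_proj σ) (measurable_glue σ)]
  simp only [Function.comp_def, proj_glue]
  exact measurePreserving_snd.map_eq

lemma glue_proj_eq_ouPoint (σ : Finset ι) (v w : EuclideanSpace ℝ ι) :
    glue σ (proj σ w) (proj σᶜ v) = ouPoint (fun i => if i ∈ σ then 0 else 1) v w := by
  ext i
  by_cases hi : i ∈ σ <;> simp [glue, proj, ouPoint, hi]

lemma measurable_marginal {h : EuclideanSpace ℝ ι → ℝ} (hm : Measurable h) (σ : Finset ι) :
    Measurable (marginal h σ) :=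
  ((hm.comp (measurable_glue σ)).stronglyMeasurable.integral_prod_right').measurable

/-- Coefficient `0` replaces a coordinate by fresh Gaussian noise and coefficient `1` keeps it, so
the terms of the subset expansion are entropies of marginals. -/
lemma marginal_proj_eq_ouAverage {h : EuclideanSpace ℝ ι → ℝ} (hm : Measurable h) (σ : Finset ι)
    (v : EuclideanSpace ℝ ι) :
    marginal h σ (proj σᶜ v) = ouAverage h (fun i => if i ∈ σ then 0 else 1) v := by
  have : Measurable fun y => h (glue σ y (proj σᶜ v)) :=
    hm.comp ((measurable_glue σ).comp measurable_prodMk_left)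
  unfold marginal ouAverage
  rw [← integral_comp_measurePreserving (measurePreserving_proj σ) this.aestronglyMeasurable]
  simp only [glue_proj_eq_ouPoint]

lemma marginal_congr_ae (σ : Finset ι) {f g : EuclideanSpace ℝ ι → ℝ}
    (h : f =ᵐ[gaussMeasure ι] g) :
    marginal f σ =ᵐ[gaussMeasure (σᶜ : Finset ι)] marginal g σ := by
  have := Measure.ae_ae_of_ae_prod ((measurePreserving_glue σ).quasiMeasurePreserving.ae h)
  filter_upwards [this] with v hv
  exact integral_congr_ae hv

/-- The logarithm depends only on the variables outside `σ`; integrating the others first turns the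
factor `h` into its marginal. As `h ≥ 0`, the same computation with absolute values gives
integrability. -/
lemma integrable_mul_log_marginal {h : EuclideanSpace ℝ ι → ℝ} (hm : Measurable h)
    (h0 : ∀ x, 0 ≤ h x) (hi : Integrable h (gaussMeasure ι))
    (hl : Integrable (fun x => mulLog (h x)) (gaussMeasure ι)) (σ : Finset ι) :
    Integrable (fun v => h v * Real.log (marginal h σ (proj σᶜ v))) (gaussMeasure ι) ∧
      ∫ v, h v * Real.log (marginal h σ (proj σᶜ v)) ∂(gaussMeasure ι) =
        ∫ v, mulLog (marginal h σ (proj σᶜ v)) ∂(gaussMeasure ι) := by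
  have hmp := measurePreserving_glue σ
  have hmm := measurable_marginal hm σ
  have hmeas : Measurable fun v => h v * Real.log (marginal h σ (proj σᶜ v)) :=
    hm.mul (hmm.comp (measurable_proj _)).log
  have hi' : Integrable (fun z : EuclideanSpace ℝ (σᶜ : Finset ι) × EuclideanSpace ℝ σ =>
      h (glue σ z.2 z.1)) ((gaussMeasure (σᶜ : Finset ι)).prod (gaussMeasure σ)) :=
    hmp.integrable_comp_of_integrable hi
  have hE : Integrable (fun x => mulLog (marginal h σ x)) (gaussMeasure (σᶜ : Finset ι)) :=
    integrable_mulLog_integral (F := fun z : EuclideanSpace ℝ (σᶜ : Finset ι) ×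
      EuclideanSpace ℝ σ => h (glue σ z.2 z.1)) (hm.comp (measurable_glue σ)) (fun _ => h0 _)
      hi' (hmp.integrable_comp_of_integrable hl)
  have hprod : Integrable (fun z : EuclideanSpace ℝ (σᶜ : Finset ι) × EuclideanSpace ℝ σ =>
      h (glue σ z.2 z.1) * Real.log (marginal h σ z.1))
      ((gaussMeasure (σᶜ : Finset ι)).prod (gaussMeasure σ)) := by
    have hms : Measurable fun z : EuclideanSpace ℝ (σᶜ : Finset ι) × EuclideanSpace ℝ σ =>
        h (glue σ z.2 z.1) * Real.log (marginal h σ z.1) :=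
      (hm.comp (measurable_glue σ)).mul (hmm.comp measurable_fst).log
    rw [integrable_prod_iff hms.aestronglyMeasurable]
    have habs : ∀ x, ∫ y, ‖h (glue σ y x) * Real.log (marginal h σ x)‖ ∂(gaussMeasure σ) =
        |mulLog (marginal h σ x)| := by
      intro x
      have hx0 : 0 ≤ marginal h σ x := integral_nonneg fun _ => h0 _
      simp only [norm_mul, integral_mul_const, Real.norm_eq_abs, abs_of_nonneg (h0 _), mulLog,
        abs_mul, abs_of_nonneg hx0]
      rfl
    simp only [habs]
    exact ⟨hi'.prod_right_ae.mono fun x hx => hx.mul_const _, hE.abs⟩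
  have hcomp : ∀ z : EuclideanSpace ℝ (σᶜ : Finset ι) × EuclideanSpace ℝ σ,
      h (glue σ z.2 z.1) * Real.log (marginal h σ (proj σᶜ (glue σ z.2 z.1))) =
        h (glue σ z.2 z.1) * Real.log (marginal h σ z.1) := fun z => by rw [proj_compl_glue]
  refine ⟨(hmp.integrable_comp hmeas.aestronglyMeasurable).1
    (hprod.congr (Eventually.of_forall fun z => (hcomp z).symm)), ?_⟩
  rw [← integral_comp_measurePreserving hmp hmeas.aestronglyMeasurable,
    integral_comp_measurePreserving (measurePreserving_proj σᶜ) hE.aestronglyMeasurable]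
  simp only [hcomp]
  rw [integral_prod _ hprod]
  simp only [integral_mul_const]
  rfl

end Marginal

/-! ### Collision matrices and their singular values -/

lemma rot_row {n : ℕ} {i j : Fin n} (hij : i ≠ j) (θ : ℝ) (a : Fin n) :
    rot i j θ a = if a = i then Pi.single i (Real.cos θ) + Pi.single j (Real.sin θ)
      else if a = j then Pi.single i (-Real.sin θ) + Pi.single j (Real.cos θ)
      else Pi.single a 1 := by
  funext b
  simp only [rot, Matrix.of_apply]
  by_cases h1 : a = i
  · by_cases hbi : b = i
    · subst hbi; simp [h1, hij]
    · by_cases hbj : b = j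
      · subst hbj; simp [h1, hbi]
      · simp [h1, hbi, hbj]
  · by_cases h2 : a = j
    · by_cases hbi : b = i
      · subst hbi; simp [h2, hij, hij.symm]
      · by_cases hbj : b = j
        · subst hbj; simp [h2, hbi]
        · simp [h2, hbi, hbj, hij.symm]
    · simp only [h1, h2, if_false, Pi.single_apply, eq_comm]

lemma rot_mem_orthogonalGroup {n : ℕ} {i j : Fin n} (hij : i ≠ j) (θ : ℝ) :
    rot i j θ ∈ Matrix.orthogonalGroup (Fin n) ℝ := by
  rw [Matrix.mem_orthogonalGroup_iff]
  ext a b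
  change rot i j θ a ⬝ᵥ rot i j θ b = _
  have hsc := Real.sin_sq_add_cos_sq θ
  rw [rot_row hij, rot_row hij, Matrix.one_apply]
  by_cases ha : a = i
  · subst ha
    by_cases hb : b = a
    · subst hb; simp [hij, hij.symm]; linarith
    · by_cases hb' : b = j
      · subst hb'; simp [hij, hij.symm]; ring
      · simp [hb, hb', Ne.symm hb]
  · by_cases ha' : a = j
    · subst ha'
      by_cases hb : b = i
      · subst hb; simp [hij, hij.symm]; ring
      · by_cases hb' : b = a
        · subst hb'; simp [hij, hij.symm]; linarith
        · simp [hij.symm, hb, hb', Ne.symm hb']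
    · by_cases hb : b = i
      · subst hb; simp [ha, ha', Ne.symm ha, Ne.symm ha']
      · by_cases hb' : b = j
        · subst hb'; simp [ha, ha', hb, Ne.symm ha, Ne.symm ha']
        · simp [ha, ha', hb, hb', Pi.single_apply, eq_comm]

lemma collisionInv_mem_orthogonalGroup {n k : ℕ} (α : Fin k → Pair n) (θ : Fin k → ℝ) :
    collisionInv α θ ∈ Matrix.orthogonalGroup (Fin n) ℝ := by
  have h : (List.ofFn fun l => rot (α l).1.1 (α l).1.2 (θ l)).prod ∈
      Matrix.orthogonalGroup (Fin n) ℝ := by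
    refine Submonoid.list_prod_mem _ fun R hR => ?_
    obtain ⟨l, rfl⟩ := (List.mem_ofFn' _ _).1 hR
    exact rot_mem_orthogonalGroup (α l).2.ne _
  unfold collisionInv
  rw [Matrix.inv_eq_right_inv ((Matrix.mem_orthogonalGroup_iff _ _).1 h)]
  exact Unitary.star_mem h

lemma dotProduct_mulVec_self_of_orthogonal {n : ℕ} {A : Matrix (Fin n) (Fin n) ℝ}
    (hA : A ∈ Matrix.orthogonalGroup (Fin n) ℝ) (x : Fin n → ℝ) :
    (A *ᵥ x) ⬝ᵥ (A *ᵥ x) = x ⬝ᵥ x := by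
  rw [Matrix.dotProduct_mulVec, Matrix.vecMul_mulVec, (Matrix.mem_orthogonalGroup_iff' _ _).1 hA,
    Matrix.vecMul_one]

/-- Padding `x` with zeros, applying the isometry `A`, and discarding the last `N` coordinates
cannot increase the norm. -/
lemma dotProduct_block_mulVec_self_le {M N : ℕ} {A : Matrix (Fin (M + N)) (Fin (M + N)) ℝ}
    (hA : A ∈ Matrix.orthogonalGroup (Fin (M + N)) ℝ) (x : Fin M → ℝ) :
    let B := A.submatrix (Fin.castAdd N) (Fin.castAdd N)
    (B *ᵥ x) ⬝ᵥ (B *ᵥ x) ≤ x ⬝ᵥ x := by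
  intro B
  have h := dotProduct_mulVec_self_of_orthogonal hA (Fin.append x 0)
  have hB : ∀ a, (A *ᵥ Fin.append x 0) (Fin.castAdd N a) = (B *ᵥ x) a := by
    intro a
    simp [Matrix.mulVec, dotProduct, Fin.sum_univ_add, B]
  have hx : Fin.append x (0 : Fin N → ℝ) ⬝ᵥ Fin.append x 0 = x ⬝ᵥ x := by
    simp [dotProduct, Fin.sum_univ_add]
  rw [hx] at h
  rw [← h]
  conv_rhs => rw [dotProduct, Fin.sum_univ_add]
  simp only [hB]
  exact le_add_of_nonneg_right (Finset.sum_nonneg fun i _ => mul_self_nonneg _)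

/-- The singular values of a block of an orthogonal matrix are at most `1`. -/
lemma IsSVD.abs_le_one {M N k : ℕ} {α : Fin k → Pair (M + N)} {θ : Fin k → ℝ}
    {U V : Matrix (Fin M) (Fin M) ℝ} {γ : Fin M → ℝ} (h : IsSVD (blockA α θ) U γ V) (j : Fin M) :
    |γ j| ≤ 1 := by
  -- The test vector is the `j`-th right singular vector: a unit vector whose image under the block
  -- has norm `|γ j|`.
  have hle := dotProduct_block_mulVec_self_le (collisionInv_mem_orthogonalGroup α θ)
    (V *ᵥ Pi.single j 1)
  change (blockA α θ *ᵥ _) ⬝ᵥ (blockA α θ *ᵥ _) ≤ _ at hle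
  have hV : Vᵀ * V = 1 := (Matrix.mem_orthogonalGroup_iff' _ _).1 h.right_orthogonal
  rw [dotProduct_mulVec_self_of_orthogonal h.right_orthogonal, h.eq_mul, Matrix.mulVec_mulVec,
    Matrix.mul_assoc, hV, Matrix.mul_one, ← Matrix.mulVec_mulVec,
    dotProduct_mulVec_self_of_orthogonal h.left_orthogonal] at hle
  have hd : Matrix.diagonal γ *ᵥ Pi.single j 1 = Pi.single j (γ j) := by
    simp [Matrix.mulVec_single]
  rw [hd] at hle
  simp only [single_dotProduct, Pi.single_eq_same, mul_one] at hle
  rw [← sq_le_one_iff_abs_le_one, sq]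
  exact hle

/-! ### Assembly of the bound -/

/-- The partial entropy bound, for an arbitrary orthogonal matrix `U` and contraction `γ`. -/
theorem partial_entropy_bound {ι : Type*} [Fintype ι] [DecidableEq ι] {U : Matrix ι ι ℝ}
    (hU : U * Uᵀ = 1) {γ : ι → ℝ} (hγ : ∀ i, |γ i| ≤ 1) {h₀ : EuclideanSpace ℝ ι → ℝ}
    (hint : Integrable h₀ (gaussMeasure ι)) (hnonneg : ∀ᵐ v ∂(gaussMeasure ι), 0 ≤ h₀ v)
    (hent : HasFiniteEntropy h₀) :
    (∀ᵐ v ∂(gaussMeasure ι),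
      Integrable (fun w => rotated h₀ U (ouPoint γ v w)) (gaussMeasure ι)) ∧
    (∀ σ : Finset ι, ∀ᵐ x ∂(gaussMeasure (σᶜ : Finset ι)),
      Integrable (fun y => rotated h₀ U (glue σ y x)) (gaussMeasure σ)) ∧
    HasFiniteEntropy (ouAverage (rotated h₀ U) γ) ∧
    (∀ σ : Finset ι,
      Integrable (fun v => h₀ v * Real.log (marginal (rotated h₀ U) σ (proj σᶜ (act Uᵀ v))))
        (gaussMeasure ι)) ∧
    entropy (ouAverage (rotated h₀ U) γ) ≤
      ∑ σ : Finset ι, (∏ i ∈ σᶜ, γ i ^ 2) * (∏ j ∈ σ, (1 - γ j ^ 2)) *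
        ∫ v, h₀ v * Real.log (marginal (rotated h₀ U) σ (proj σᶜ (act Uᵀ v)))
          ∂(gaussMeasure ι) := by
  have hU' : Uᵀ * U = 1 := mul_eq_one_comm.1 hU
  have hmpU := measurePreserving_act hU
  have hmpU' := measurePreserving_act (A := Uᵀ) (by simpa using hU')
  have hrot : Integrable (rotated h₀ U) (gaussMeasure ι) := hmpU.integrable_comp_of_integrable hint
  have hentl : Integrable (fun v => mulLog (h₀ v)) (gaussMeasure ι) := hent
  have hrotl : Integrable (fun v => mulLog (rotated h₀ U v)) (gaussMeasure ι) :=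
    hmpU.integrable_comp_of_integrable (g := fun v => mulLog (h₀ v)) hentl
  have hrot0 : ∀ᵐ v ∂(gaussMeasure ι), 0 ≤ rotated h₀ U v :=
    hmpU.quasiMeasurePreserving.ae (p := fun v => 0 ≤ h₀ v) hnonneg
  -- a measurable nonnegative representative
  obtain ⟨f, hfm, hf0, hf⟩ : ∃ f : EuclideanSpace ℝ ι → ℝ, Measurable f ∧
      (∀ x, 0 ≤ f x) ∧ rotated h₀ U =ᵐ[gaussMeasure ι] f := by
    refine ⟨fun x => max 0 (hrot.aestronglyMeasurable.mk _ x),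
      measurable_const.max hrot.aestronglyMeasurable.stronglyMeasurable_mk.measurable,
      fun x => le_max_left _ _, ?_⟩
    filter_upwards [hrot0, hrot.aestronglyMeasurable.ae_eq_mk] with x hx hx'
    rw [← hx', max_eq_right hx]
  have hfi : Integrable f (gaussMeasure ι) := hrot.congr hf
  have hfl : Integrable (fun v => mulLog (f v)) (gaussMeasure ι) :=
    hrotl.congr (hf.mono fun v hv => congrArg mulLog hv)
  -- the same function on the product space
  let q : (ι → ℝ) → ℝ := fun x => f (WithLp.toLp 2 x)
  have hqm : Measurable q := hfm.comp measurePreserving_toLp_gauss.measurable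
  have hq0 : ∀ x, 0 ≤ q x := fun x => hf0 _
  have hqi : Integrable q (gaussPi ι gaussVar) :=
    measurePreserving_toLp_gauss.integrable_comp_of_integrable hfi
  have hql : Integrable (fun x => mulLog (q x)) (gaussPi ι gaussVar) :=
    measurePreserving_toLp_gauss.integrable_comp_of_integrable (g := fun v => mulLog (f v)) hfl
  have havg : ∀ (δ : ι → ℝ) v, ouAverage f δ v = ouAvg gaussVar δ q v.ofLp :=
    fun δ v => ouAverage_eq_ouAvg hqm δ v
  have hintavg : ∀ δ : ι → ℝ, (∀ i, |δ i| ≤ 1) →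
      Integrable (fun v => mulLog (ouAverage f δ v)) (gaussMeasure ι) ∧
      ∫ v, mulLog (ouAverage f δ v) ∂(gaussMeasure ι) =
        ∫ x, mulLog (ouAvg gaussVar δ q x) ∂(gaussPi ι gaussVar) := by
    intro δ hδ
    have h := integrable_mulLog_ouAvg hδ hqm hq0 hqi hql
    simp only [havg]
    exact ⟨measurePreserving_ofLp_gauss.integrable_comp_of_integrable
      (g := fun x => mulLog (ouAvg gaussVar δ q x)) h,
      integral_comp_measurePreserving measurePreserving_ofLp_gauss h.aestronglyMeasurable⟩
  have hg := ouAverage_congr_ae hγ hf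
  have hgl : (fun v => mulLog (ouAverage (rotated h₀ U) γ v)) =ᵐ[gaussMeasure ι]
      fun v => mulLog (ouAverage f γ v) := hg.mono fun v hv => congrArg mulLog hv
  have hind : ∀ (σ : Finset ι) i, |(if i ∈ σ then 0 else 1 : ℝ)| ≤ 1 := fun σ i => by
    split_ifs <;> simp
  -- the terms on the right, up to the rotation
  have hterm : ∀ σ : Finset ι,
      (fun v => h₀ v * Real.log (marginal (rotated h₀ U) σ (proj σᶜ (act Uᵀ v))))
        =ᵐ[gaussMeasure ι] fun v => (fun u => f u * Real.log (marginal f σ (proj σᶜ u)))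
          (act Uᵀ v) := by
    intro σ
    -- Since `U * Uᵀ = 1`, the factor `h₀ v` is the rotated function at `Uᵀ v`. The whole integrand
    -- is thus a function of `Uᵀ v`, and invariance of the measure removes the rotation.
    have h1 := (measurePreserving_proj σᶜ).quasiMeasurePreserving.ae (marginal_congr_ae σ hf)
    have h2 := hmpU'.quasiMeasurePreserving.ae (hf.and h1)
    filter_upwards [h2] with v hv
    have e : rotated h₀ U (act Uᵀ v) = h₀ v := by
      rw [rotated, act_act, hU, act_one]
    rw [← hv.1, ← hv.2, e]
  have hmul := integrable_mul_log_marginal hfm hf0 hfi hfl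
  have hpoint : Integrable (fun z : EuclideanSpace ℝ ι × EuclideanSpace ℝ ι =>
      rotated h₀ U (ouPoint γ z.1 z.2)) ((gaussMeasure ι).prod (gaussMeasure ι)) :=
    (measurePreserving_ouPoint hγ).integrable_comp_of_integrable hrot
  have hglue : ∀ σ : Finset ι, Integrable
      (fun z : EuclideanSpace ℝ (σᶜ : Finset ι) × EuclideanSpace ℝ σ =>
        rotated h₀ U (glue σ z.2 z.1))
      ((gaussMeasure (σᶜ : Finset ι)).prod (gaussMeasure σ)) := fun σ =>
    (measurePreserving_glue σ).integrable_comp_of_integrable hrot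
  refine ⟨hpoint.prod_right_ae, fun σ => (hglue σ).prod_right_ae, 
    (hintavg γ hγ).1.congr hgl.symm, fun σ => ?_, ?_⟩
  · exact (hmpU'.integrable_comp_of_integrable (hmul σ).1).congr (hterm σ).symm
  · calc entropy (ouAverage (rotated h₀ U) γ)
        = ∫ x, mulLog (ouAvg gaussVar γ q x) ∂(gaussPi ι gaussVar) :=
          (integral_congr_ae hgl).trans (hintavg γ hγ).2
      _ ≤ _ := integral_mulLog_ouAvg_le_sum hγ hqm hq0 hqi hql
      _ = _ := Finset.sum_congr rfl fun σ _ => by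
        rw [integral_congr_ae (hterm σ),
          integral_comp_measurePreserving hmpU' (hmul σ).1.aestronglyMeasurable, (hmul σ).2,
          ← (hintavg _ (hind σ)).2]
        simp only [marginal_proj_eq_ouAverage hfm]

end KacEntropy

theorem theorem3p1 (M N k : ℕ) (α : Fin k → KacEntropy.Pair (M + N)) (θ : Fin k → ℝ)
    (U V : Matrix (Fin M) (Fin M) ℝ) (γ : Fin M → ℝ)
    (hsvd : KacEntropy.IsSVD (KacEntropy.blockA α θ) U γ V)
    (h₀ : EuclideanSpace ℝ (Fin M) → ℝ)
    (hint : Integrable h₀ (KacEntropy.gaussMeasure (Fin M)))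
    (hnonneg : ∀ᵐ v ∂(KacEntropy.gaussMeasure (Fin M)), 0 ≤ h₀ v)
    (hent : KacEntropy.HasFiniteEntropy h₀) :
    -- the average `g` and the marginals are well defined almost everywhere
    (∀ᵐ v ∂(KacEntropy.gaussMeasure (Fin M)),
      Integrable (fun w => KacEntropy.rotated h₀ U (KacEntropy.ouPoint γ v w))
        (KacEntropy.gaussMeasure (Fin M))) ∧
    (∀ σ : Finset (Fin M), ∀ᵐ x ∂(KacEntropy.gaussMeasure (σᶜ : Finset (Fin M))),
      Integrable (fun y => KacEntropy.rotated h₀ U (KacEntropy.glue σ y x))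
        (KacEntropy.gaussMeasure σ)) ∧
    -- all the integrals in the inequality converge
    KacEntropy.HasFiniteEntropy (KacEntropy.ouAverage (KacEntropy.rotated h₀ U) γ) ∧
    (∀ σ : Finset (Fin M),
      Integrable
        (fun v => h₀ v * Real.log (KacEntropy.marginal (KacEntropy.rotated h₀ U) σ
          (KacEntropy.proj σᶜ (KacEntropy.act Uᵀ v))))
        (KacEntropy.gaussMeasure (Fin M))) ∧
    -- the partial entropy bound
    KacEntropy.entropy (KacEntropy.ouAverage (KacEntropy.rotated h₀ U) γ) ≤
      ∑ σ : Finset (Fin M), (∏ i ∈ σᶜ, γ i ^ 2) * (∏ j ∈ σ, (1 - γ j ^ 2)) *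
        ∫ v, h₀ v * Real.log (KacEntropy.marginal (KacEntropy.rotated h₀ U) σ
          (KacEntropy.proj σᶜ (KacEntropy.act Uᵀ v))) ∂(KacEntropy.gaussMeasure (Fin M)) := by
  exact KacEntropy.partial_entropy_bound
    ((Matrix.mem_orthogonalGroup_iff _ _).1 hsvd.left_orthogonal) hsvd.abs_le_one hint hnonneg hent
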